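/- Let $N\ge 1$, let $S\subset\mathbb R^d$ be symmetric ($v\in S\Rightarrow -v\in S$), and put $\|x\|_S=\sup_{v\in S}\langle v,x\rangle\in[0,\infty]$ (with $\|x\|_S=0$ if $S=\emptyset$). Let $\tilde X_1,\dots,\tilde X_N$ be independent random vectors in $\mathbb R^d$ with finite second moments and common mean $\mu^*$, and let $\Sigma\in\mathbb R^{d\times d}$ be a symmetric positive semidefinite matrix with $\mathbb E(\tilde X_i-\mu^*)(\tilde X_i-\mu^*)^\top\preceq\Sigma$ for all $i$. An adversary modifies in an arbitrary way (possibly depending on all of the data) at most $|\mathcal O|$ of these vectors; this yields the observed data $X_1,\dots,X_N$, so that $X_i=\tilde X_i$ for all but at most $|\mathcal O|$ (random) indices $i$. Let $K$ be an integer with $K>16|\mathcal O|$ such that $4$ divides $K+1$, let $B_1\sqcup\dots\sqcup B_K=\{1,\dots,N\}$ be a partition into $K$ blocks of equal size $N/K$, and let $\bar X_k=|B_k|^{-1}\sum_{i\in B_k}X_i$. For $v\in\mathbb R^d$ let $\langle \bar X_k,v\rangle^*_{(1)}\le\dots\le\langle\bar X_k,v\rangle^*_{(K)}$ be the nondecreasing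 rearrangement of $(\langle\bar X_k,v\rangle)_{k=1}^K$, and put $$f(v)=\frac1{|I_K|}\sum_{k\in I_K}\langle\bar X_k,v\rangle^*_{(k)},\qquad g(v)=\langle\bar X_k,v\rangle^*_{\left(\frac{K+1}2\right)},\qquad I_K=\Big\{k\in\mathbb N:\tfrac{K+1}4\le k\le\tfrac{3(K+1)}4\Big\}.$$ For $h\in\{f,g\}$ let $h^*_S(\mu)=\sup_{v\in S}(\langle\mu,v\rangle-h(v))$, $\mu\in\mathbb R^d$, with values in the extended reals. Let $$r^*_S=\max\left(\frac{64}{\sqrt N}\,\mathbb E\Big\|\frac1{\sqrt N}\sum_{i=1}^N\varepsilon_i(\tilde X_i-\mu^*)\Big\|_S,\ \sup_{v\in S}\|\Sigma^{1/2}v\|_2\sqrt{\frac{64K}N}\right)\in[0,\infty],$$ where $\varepsilon_1,\dots,\varepsilon_N$ are i.i.d. Rademacher variables independent of the $\tilde X_i$. Then, with probability at least $1-\exp(-K/512)$, all $\hat\mu^f_S\in\operatorname{argmin}_{\mu\in\mathbb R^d}f^*_S(\mu)$ and $\hat\mu^g_S\in\operatorname{argmin}_{\mu\in\mathbb R^d}g^*_S(\mu)$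 satisfy $$\|\hat\mu^f_S-\mu^*\|_S\le 2r^*_S\qquad\text{and}\qquad\|\hat\mu^g_S-\mu^*\|_S\le 2r^*_S.$$ (If the event in question is not measurable, this means that it contains a measurable event of at least that probability.) -/

import Mathlib

open MeasureTheory ProbabilityTheory
open scoped ENNReal MatrixOrder RealInnerProductSpace

noncomputable section

namespace MOM

/-- The pseudo-norm `‖x‖_S = sup_{v ∈ S} ⟨v, x⟩`, with values in `[0, ∞]`, so that no boundedness of
`S` is needed. Truncating each term at `0` does not change the supremum when `S` is symmetric and
nonempty. -/
def pseudoNorm {d : ℕ} (S : Set (EuclideanSpace ℝ (Fin d))) (x : EuclideanSpace ℝ (Fin d)) : ℝ≥0∞ :=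
  ⨆ v ∈ S, ENNReal.ofReal ⟪v, x⟫

/-- The Fenchel–Legendre transform on `S`: `μ ↦ sup_{v ∈ S} (⟨μ, v⟩ - f v)`. -/
def fenchelLegendre {d : ℕ} (S : Set (EuclideanSpace ℝ (Fin d)))
    (f : EuclideanSpace ℝ (Fin d) → ℝ) (μ : EuclideanSpace ℝ (Fin d)) : EReal :=
  ⨆ v ∈ S, ((⟪μ, v⟫ - f v : ℝ) : EReal)

/-- The `j`-th order statistic `a*_(j)`, `1 ≤ j ≤ K`, of `a_1, …, a_K`:
the `j`-th entry of the nondecreasing rearrangement of `a`. -/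
def orderStat {K : ℕ} (a : Fin K → ℝ) (j : ℕ) : ℝ :=
  if h : 1 ≤ j ∧ j ≤ K then a (Tuple.sort a ⟨j - 1, by omega⟩) else 0

/-- The inter-quartile index set `I_K = [(K+1)/4, 3(K+1)/4]` (used when `4 ∣ K + 1`). -/
def interQuartile (K : ℕ) : Finset ℕ := Finset.Icc ((K + 1) / 4) (3 * (K + 1) / 4)

/-- `B i` is the block that contains the index `i`; the `K` blocks all have size `N / K`. -/
def IsEquipartition {N K : ℕ} (B : Fin N → Fin K) : Prop :=
  ∀ k, K * (Finset.univ.filter fun i => B i = k).card = N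

/-- The mean of the data over the `k`-th block. -/
def blockMean {d N K : ℕ} (B : Fin N → Fin K) (x : Fin N → EuclideanSpace ℝ (Fin d))
    (k : Fin K) : EuclideanSpace ℝ (Fin d) :=
  ((Finset.univ.filter fun i => B i = k).card : ℝ)⁻¹ • ∑ i with B i = k, x i

/-- The average of the inter-quartile values of the projected block means `⟨X̄_k, v⟩`. -/
def interQuartileMean {d N K : ℕ} (B : Fin N → Fin K) (x : Fin N → EuclideanSpace ℝ (Fin d))
    (v : EuclideanSpace ℝ (Fin d)) : ℝ :=
  ((interQuartile K).card : ℝ)⁻¹ *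
    ∑ j ∈ interQuartile K, orderStat (fun k => ⟪blockMean B x k, v⟫) j

/-- The median (the `(K+1)/2`-th order statistic) of the projected block means `⟨X̄_k, v⟩`. -/
def blockMedian {d N K : ℕ} (B : Fin N → Fin K) (x : Fin N → EuclideanSpace ℝ (Fin d))
    (v : EuclideanSpace ℝ (Fin d)) : ℝ :=
  orderStat (fun k => ⟪blockMean B x k, v⟫) ((K + 1) / 2)

/-- The Rademacher distribution on `{-1, 1}`. -/
def rademacher : Measure ℝ :=
  (2⁻¹ : ℝ≥0∞) • Measure.dirac (-1) + (2⁻¹ : ℝ≥0∞) • Measure.dirac 1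

/-- The matrix `E (Y - μ)(Y - μ)ᵀ`. -/
def secondMoment {d : ℕ} {Ω : Type*} [MeasurableSpace Ω] (P : Measure Ω)
    (Y : Ω → EuclideanSpace ℝ (Fin d)) (μ : EuclideanSpace ℝ (Fin d)) :
    Matrix (Fin d) (Fin d) ℝ :=
  Matrix.of fun a b => ∫ ω, (Y ω a - μ a) * (Y ω b - μ b) ∂P

/-- The Rademacher complexity `E ‖N^{-1/2} ∑ ε_i (Y_i - μ)‖_S`, where `(ε_i)` are i.i.d. Rademacher
variables independent of `(Y_i)`. -/
def rademacherComplexity {d N : ℕ} {Ω : Type*} [MeasurableSpace Ω] (P : Measure Ω)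
    (S : Set (EuclideanSpace ℝ (Fin d))) (Y : Fin N → Ω → EuclideanSpace ℝ (Fin d))
    (μ : EuclideanSpace ℝ (Fin d)) : ℝ≥0∞ :=
  ∫⁻ p : Ω × (Fin N → ℝ), pseudoNorm S ((√(N : ℝ))⁻¹ • ∑ i, p.2 i • (Y i p.1 - μ))
    ∂(P.prod (Measure.pi fun _ : Fin N => rademacher))

/-- The weak variance term `sup_{v ∈ S} ‖Σ^{1/2} v‖_2`. -/
def weakVariance {d : ℕ} (S : Set (EuclideanSpace ℝ (Fin d))) (Sig : Matrix (Fin d) (Fin d) ℝ) :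
    ℝ≥0∞ :=
  ⨆ v ∈ S, ENNReal.ofReal ‖Matrix.toEuclideanLin (CFC.sqrt Sig) v‖

/-- The rate `r*_S`. -/
def rate {d N : ℕ} {Ω : Type*} [MeasurableSpace Ω] (P : Measure Ω)
    (S : Set (EuclideanSpace ℝ (Fin d))) (Sig : Matrix (Fin d) (Fin d) ℝ) (K : ℕ)
    (Y : Fin N → Ω → EuclideanSpace ℝ (Fin d)) (μ : EuclideanSpace ℝ (Fin d)) : ℝ≥0∞ :=
  max (ENNReal.ofReal (64 / √(N : ℝ)) * rademacherComplexity P S Y μ)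
    (weakVariance S Sig * ENNReal.ofReal (√(64 * K / N)))

end MOM

end

open MeasureTheory ProbabilityTheory
open scoped ENNReal MatrixOrder RealInnerProductSpace

noncomputable section

namespace MOM

/-! ### The deterministic part -/

section Deterministic

variable {d N K : ℕ} {S : Set (EuclideanSpace ℝ (Fin d))}

/-! The proof separates a deterministic argument from a uniform count of bad blocks. Suppose that
for each `v` in `S` fewer than `(K + 1) / 4` block means exceed `⟪μ, v⟫` by more than `r` in
direction `v`. Applied to `v` and `-v`, this puts every inter-quartile order statistic, hence `f v`
and `g v`, within `r` of `⟪μ, v⟫`. The transform is then at most `r` at `μ`, so also at a minimizer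
`ν`, and `⟪ν - μ, v⟫ ≤ 2 * r` follows (`pseudoNorm_sub_le_of_isMinOn`).

For the count, the indicator of a deviation beyond `r` is dominated by a 2-Lipschitz ramp of the
rescaled deviation. The maximum over directions of the ramp sum has expectation at most `9 * K /
64`: the means contribute `K / 64` by the second moment bound, and the centered process contributes
`8 * (K / 64)` by symmetrization, contraction and a second symmetrization inside the blocks
(`integral_coordMax_sum_ramp_sub_le`). Bounded differences add `K / 32` with failure probability
`exp (-K / 512)` (`measure_coordMax_sum_ge_le`). So fewer than `11 * K / 64` clean blocks are bad;
the adversary spoils fewer than `4 * K / 64` more, and the total stays below `K / 4`.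

Probabilistic estimates are made on finite sets of directions, where maxima are measurable and
integrable, with bounds independent of the set. Strictness of the deviation inequality carries them
to all of `S`. -/

theorem orderStat_le {a : Fin K → ℝ} {j : ℕ} {r : ℝ} (hj : 1 ≤ j)
    (h : (Finset.univ.filter fun k => r < a k).card + j ≤ K) : orderStat a j ≤ r := by
  have hjK : 1 ≤ j ∧ j ≤ K := ⟨hj, by omega⟩
  rw [orderStat, dif_pos hjK]
  by_contra! hlt
  have hsub : (Finset.Ici (⟨j - 1, by omega⟩ : Fin K)).image (Tuple.sort a) ⊆
      Finset.univ.filter fun k => r < a k := by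
    intro k hk
    obtain ⟨i, hi, rfl⟩ := Finset.mem_image.1 hk
    simp only [Finset.mem_filter, Finset.mem_univ, true_and]
    exact hlt.trans_le (Tuple.monotone_sort a (Finset.mem_Ici.1 hi))
  have hcard := Finset.card_le_card hsub
  -- The 0-based positions from `j - 1` on number `K - j + 1`, one more than the hypothesis allows
  -- above `r`.
  rw [Finset.card_image_of_injective _ (Equiv.injective _), Fin.card_Ici] at hcard
  simp only at hcard
  omega

theorem le_orderStat {a : Fin K → ℝ} {j : ℕ} {r : ℝ} (hj : j ≤ K)
    (h : (Finset.univ.filter fun k => a k < r).card < j) : r ≤ orderStat a j := by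
  have hjK : 1 ≤ j ∧ j ≤ K := ⟨by omega, hj⟩
  rw [orderStat, dif_pos hjK]
  by_contra! hlt
  have hsub : (Finset.Iic (⟨j - 1, by omega⟩ : Fin K)).image (Tuple.sort a) ⊆
      Finset.univ.filter fun k => a k < r := by
    intro k hk
    obtain ⟨i, hi, rfl⟩ := Finset.mem_image.1 hk
    simp only [Finset.mem_filter, Finset.mem_univ, true_and]
    exact (Tuple.monotone_sort a (Finset.mem_Iic.1 hi)).trans_lt hlt
  have hcard := Finset.card_le_card hsub
  rw [Finset.card_image_of_injective _ (Equiv.injective _), Fin.card_Iic] at hcard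
  simp only at hcard
  omega

/-- With `4 ∣ K + 1` the quartile bounds are exact: at most `(K + 1) / 4 - 1` entries lie on either
bad side, and adding `j ≤ 3 * (K + 1) / 4` gives at most `K`. -/
theorem abs_orderStat_sub_le {a : Fin K → ℝ} {c r : ℝ} {j : ℕ} (hj : j ∈ interQuartile K)
    (hK : 4 ∣ K + 1) (hup : 4 * (Finset.univ.filter fun k => c + r < a k).card < K + 1)
    (hlow : 4 * (Finset.univ.filter fun k => a k < c - r).card < K + 1) :
    |orderStat a j - c| ≤ r := by
  obtain ⟨h1, h2⟩ := Finset.mem_Icc.1 hj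
  have h3 := orderStat_le (a := a) (j := j) (r := c + r) (by omega) (by omega)
  have h4 := le_orderStat (a := a) (j := j) (r := c - r) (by omega) (by omega)
  exact abs_sub_le_iff.2 ⟨by linarith, by linarith⟩

theorem abs_inv_card_mul_sum_sub_le {ι : Type*} {s : Finset ι} (hs : s.Nonempty) {f : ι → ℝ}
    {c r : ℝ} (h : ∀ i ∈ s, |f i - c| ≤ r) : |(s.card : ℝ)⁻¹ * ∑ i ∈ s, f i - c| ≤ r := by
  have hpos : (0 : ℝ) < s.card := by exact_mod_cast hs.card_pos
  have heq : (s.card : ℝ)⁻¹ * ∑ i ∈ s, f i - c = (s.card : ℝ)⁻¹ * ∑ i ∈ s, (f i - c) := by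
    rw [Finset.sum_sub_distrib, Finset.sum_const, nsmul_eq_mul]
    field_simp
  rw [heq, abs_mul, abs_of_pos (inv_pos.2 hpos), inv_mul_le_iff₀ hpos, ← nsmul_eq_mul]
  exact (Finset.abs_sum_le_sum_abs _ _).trans (Finset.sum_le_card_nsmul _ _ _ h)

/-- If `f` approximates `⟨·, μ⟩` up to `r` on `S`, then every minimizer of its transform is
`2 r`-close to `μ`. -/
theorem pseudoNorm_sub_le_of_isMinOn {f : EuclideanSpace ℝ (Fin d) → ℝ}
    {μ ν : EuclideanSpace ℝ (Fin d)} {r : ℝ} (hf : ∀ v ∈ S, |f v - ⟪μ, v⟫| ≤ r)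
    (hν : IsMinOn (fenchelLegendre S f) Set.univ ν) :
    pseudoNorm S (ν - μ) ≤ ENNReal.ofReal (2 * r) := by
  refine iSup₂_le fun v hv => ENNReal.ofReal_le_ofReal ?_
  -- The transform is at most `r` at `μ`; minimality transfers this bound to `ν`.
  have h1 : fenchelLegendre S f μ ≤ (r : EReal) := by
    refine iSup₂_le fun w hw => EReal.coe_le_coe_iff.2 ?_
    have := (abs_sub_le_iff.1 (hf w hw)).2
    linarith
  have h2 : ((⟪ν, v⟫ - f v : ℝ) : EReal) ≤ (r : EReal) :=
    (le_iSup₂ (f := fun w (_ : w ∈ S) => ((⟪ν, w⟫ - f w : ℝ) : EReal)) v hv).trans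
      ((isMinOn_iff.1 hν μ (Set.mem_univ _)).trans h1)
  have h3 := EReal.coe_le_coe_iff.1 h2
  have h4 := (abs_sub_le_iff.1 (hf v hv)).1
  rw [inner_sub_right, real_inner_comm, real_inner_comm μ v]
  linarith

theorem abs_interQuartileMean_sub_le {B : Fin N → Fin K} {x : Fin N → EuclideanSpace ℝ (Fin d)}
    {μ v : EuclideanSpace ℝ (Fin d)} {r : ℝ} (hK : 4 ∣ K + 1)
    (hup : 4 * (Finset.univ.filter fun k => r < ⟪blockMean B x k - μ, v⟫).card < K + 1)
    (hlow : 4 * (Finset.univ.filter fun k => r < ⟪blockMean B x k - μ, -v⟫).card < K + 1) :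
    |interQuartileMean B x v - ⟪μ, v⟫| ≤ r ∧ |blockMedian B x v - ⟪μ, v⟫| ≤ r := by
  have hup' : 4 * (Finset.univ.filter fun k => ⟪μ, v⟫ + r < ⟪blockMean B x k, v⟫).card < K + 1 := by
    simpa only [inner_sub_left, lt_sub_iff_add_lt'] using hup
  have hlow' : 4 * (Finset.univ.filter fun k => ⟪blockMean B x k, v⟫ < ⟪μ, v⟫ - r).card
      < K + 1 := by
    have key : ∀ k, ⟪blockMean B x k, v⟫ < ⟪μ, v⟫ - r ↔ r < ⟪blockMean B x k - μ, -v⟫ := by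
      intro k
      rw [inner_neg_right, inner_sub_left, neg_sub]
      exact lt_sub_comm
    simpa only [key] using hlow
  refine ⟨abs_inv_card_mul_sum_sub_le ?_ fun j hj => abs_orderStat_sub_le hj hK hup' hlow', ?_⟩
  · exact Finset.nonempty_Icc.2 (by omega)
  · exact abs_orderStat_sub_le (Finset.mem_Icc.2 (by omega)) hK hup' hlow'

/-- Modifying `m` data points changes at most `m` block means. -/
theorem card_blockMean_le {B : Fin N → Fin K} {x y : Fin N → EuclideanSpace ℝ (Fin d)}
    (p : EuclideanSpace ℝ (Fin d) → Prop) [DecidablePred p] :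
    (Finset.univ.filter fun k => p (blockMean B x k)).card ≤
      (Finset.univ.filter fun k => p (blockMean B y k)).card + {i | x i ≠ y i}.ncard := by
  classical
  have hsub : (Finset.univ.filter fun k => p (blockMean B x k)) ⊆
      (Finset.univ.filter fun k => p (blockMean B y k)) ∪
        (Finset.univ.filter fun i => x i ≠ y i).image B := by
    intro k hk
    by_cases h : ∃ i, x i ≠ y i ∧ B i = k
    · obtain ⟨i, hi, rfl⟩ := h
      exact Finset.mem_union_right _ (Finset.mem_image_of_mem _ (by simpa using hi))
    · push Not at h
      refine Finset.mem_union_left _ ?_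
      have heq : blockMean B x k = blockMean B y k := by
        unfold blockMean
        congr 1
        refine Finset.sum_congr rfl fun i hi => ?_
        by_contra hne
        exact h i hne (Finset.mem_filter.1 hi).2
      simpa [heq] using hk
  refine (Finset.card_le_card hsub).trans ((Finset.card_union_le _ _).trans ?_)
  gcongr
  refine Finset.card_image_le.trans (le_of_eq ?_)
  rw [Set.ncard_eq_toFinset_card']
  congr 1
  ext i
  simp

end Deterministic

/-! ### The maximal coordinate and the ramp function -/

section CoordMax

variable {F : Type*} [Fintype F] [Nonempty F]

/-- The largest coordinate of a vector. -/
def coordMax (u : F → ℝ) : ℝ := Finset.univ.sup' Finset.univ_nonempty u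

theorem le_coordMax (u : F → ℝ) (v : F) : u v ≤ coordMax u :=
  Finset.le_sup' u (Finset.mem_univ v)

theorem coordMax_le {u : F → ℝ} {c : ℝ} (h : ∀ v, u v ≤ c) : coordMax u ≤ c :=
  Finset.sup'_le _ _ fun v _ => h v

theorem exists_coordMax_eq (u : F → ℝ) : ∃ v, coordMax u = u v := by
  obtain ⟨v, -, hv⟩ := Finset.exists_mem_eq_sup' Finset.univ_nonempty u
  exact ⟨v, hv⟩

theorem coordMax_smul {c : ℝ} (hc : 0 ≤ c) (u : F → ℝ) : coordMax (c • u) = c * coordMax u := by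
  refine le_antisymm (coordMax_le fun v => mul_le_mul_of_nonneg_left (le_coordMax u v) hc) ?_
  obtain ⟨v, hv⟩ := exists_coordMax_eq u
  rw [hv]
  exact le_coordMax (c • u) v

theorem coordMax_sub_le (u w : F → ℝ) : coordMax u - coordMax w ≤ ‖u - w‖ := by
  obtain ⟨v, hv⟩ := exists_coordMax_eq u
  have h1 := le_coordMax w v
  have h2 := (le_abs_self _).trans (norm_le_pi_norm (u - w) v)
  simp only [Pi.sub_apply] at h2
  linarith

theorem abs_coordMax_le (u : F → ℝ) : |coordMax u| ≤ ‖u‖ := by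
  have h0 : coordMax (0 : F → ℝ) = 0 := by
    obtain ⟨v, hv⟩ := exists_coordMax_eq (0 : F → ℝ)
    simpa using hv
  have h1 := coordMax_sub_le u 0
  have h2 := coordMax_sub_le 0 u
  simp only [h0, sub_zero, zero_sub, norm_neg] at h1 h2
  exact abs_le.2 ⟨by linarith, h1⟩

@[fun_prop]
theorem continuous_coordMax : Continuous (coordMax : (F → ℝ) → ℝ) := by
  refine (LipschitzWith.of_dist_le_mul (K := 1) fun u w => ?_).continuous
  rw [Real.dist_eq, dist_eq_norm, NNReal.coe_one, one_mul]
  refine abs_sub_le_iff.2 ⟨coordMax_sub_le u w, ?_⟩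
  rw [norm_sub_rev]
  exact coordMax_sub_le w u

@[fun_prop]
theorem measurable_coordMax : Measurable (coordMax : (F → ℝ) → ℝ) := continuous_coordMax.measurable

/-- Convexity of the maximum. It permits symmetrization without an independent copy, at the price of
the factor 2. -/
theorem coordMax_midpoint_le (h x y : F → ℝ) :
    coordMax (h + x - y) ≤
      (1 / 2) * coordMax (h + (2 : ℝ) • x) + (1 / 2) * coordMax (h - (2 : ℝ) • y) := by
  refine coordMax_le fun v => ?_
  have h1 := le_coordMax (h + (2 : ℝ) • x) v
  have h2 := le_coordMax (h - (2 : ℝ) • y) v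
  simp only [Pi.add_apply, Pi.sub_apply, Pi.smul_apply, smul_eq_mul] at h1 h2 ⊢
  linarith

/-- The contraction principle for one coordinate. -/
theorem coordMax_contraction {φ : ℝ → ℝ} {L : ℝ} (hφ : ∀ s t, |φ s - φ t| ≤ L * |s - t|)
    (h t : F → ℝ) :
    coordMax (h + φ ∘ t) + coordMax (h - φ ∘ t) ≤ coordMax (h + L • t) + coordMax (h - L • t) := by
  obtain ⟨v, hv⟩ := exists_coordMax_eq (h + φ ∘ t)
  obtain ⟨w, hw⟩ := exists_coordMax_eq (h - φ ∘ t)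
  have h1 := le_coordMax (h + L • t) v
  have h2 := le_coordMax (h - L • t) w
  have h3 := le_coordMax (h + L • t) w
  have h4 := le_coordMax (h - L • t) v
  rw [hv, hw]
  simp only [Pi.add_apply, Pi.sub_apply, Pi.smul_apply, smul_eq_mul, Function.comp_apply]
    at h1 h2 h3 h4 ⊢
  have h5 := (le_abs_self _).trans (hφ (t v) (t w))
  -- If `t v ≥ t w`, adding `h1` and `h2` suffices; otherwise the two maximizers exchange roles and
  -- `h3`, `h4` are added.
  rcases abs_cases (t v - t w) with ⟨he, -⟩ | ⟨he, -⟩ <;> rw [he] at h5 <;> linarith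

end CoordMax

/-- The continuous ramp that vanishes on `(-∞, 1/2]` and equals `1` on `[1, ∞)`. -/
def ramp (t : ℝ) : ℝ := max 0 (min 1 (2 * t - 1))

theorem ramp_nonneg (t : ℝ) : 0 ≤ ramp t := le_max_left _ _

theorem ramp_le_one (t : ℝ) : ramp t ≤ 1 := max_le zero_le_one (min_le_left _ _)

theorem ramp_of_one_le {t : ℝ} (ht : 1 ≤ t) : ramp t = 1 := by
  rw [ramp, min_eq_left (by linarith), max_eq_right zero_le_one]

/-- The sloped part of the ramp is the tangent to `t ^ 2` at `1`, so the second moment bound loses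
no constant. -/
theorem ramp_le_sq (t : ℝ) : ramp t ≤ t ^ 2 :=
  max_le (sq_nonneg t) ((min_le_right _ _).trans (by nlinarith [sq_nonneg (t - 1)]))

theorem abs_ramp_sub_le (s t : ℝ) : |ramp s - ramp t| ≤ 2 * |s - t| := by
  have h1 := abs_max_sub_max_le_abs (min 1 (2 * s - 1)) (min 1 (2 * t - 1)) 0
  have h2 := abs_min_sub_min_le_max 1 (2 * s - 1) 1 (2 * t - 1)
  rw [max_comm _ (0 : ℝ), max_comm _ (0 : ℝ)] at h1
  refine h1.trans (h2.trans (max_le (by simp) (le_of_eq ?_)))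
  rw [show 2 * s - 1 - (2 * t - 1) = 2 * (s - t) by ring, abs_mul, abs_two]

@[fun_prop]
theorem continuous_ramp : Continuous ramp := by unfold ramp; fun_prop

@[fun_prop]
theorem measurable_ramp : Measurable ramp := continuous_ramp.measurable

/-! ### Independence -/

section Independence

variable {Ω : Type*} [MeasurableSpace Ω] {P : Measure Ω}

theorem map_prodMk_eq_map_prod [IsProbabilityMeasure P] {α β : Type*} [MeasurableSpace α]
    [MeasurableSpace β] {X : Ω → α} {Y : Ω → β} (h : IndepFun X Y P) (hX : Measurable X)
    (hY : Measurable Y) : P.map (fun ω => (X ω, Y ω)) = (P.prod P).map (Prod.map X Y) := by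
  rw [h.map_prod_eq_prod_map_map hX.aemeasurable hY.aemeasurable, Measure.map_prod_map _ _ hX hY]

/-- Fubini's theorem for two independent random variables. -/
theorem integral_comp_of_indepFun [IsProbabilityMeasure P] {α β : Type*} [MeasurableSpace α]
    [MeasurableSpace β] {X : Ω → α} {Y : Ω → β} (h : IndepFun X Y P) (hX : Measurable X)
    (hY : Measurable Y) {g : α → β → ℝ} (hg : Measurable (Function.uncurry g))
    (hint : Integrable (fun p : Ω × Ω => g (X p.1) (Y p.2)) (P.prod P)) :
    ∫ ω, g (X ω) (Y ω) ∂P = ∫ ω, ∫ ω', g (X ω) (Y ω') ∂P ∂P := by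
  rw [integral_integral hint]
  have h1 : ∫ ω, g (X ω) (Y ω) ∂P = ∫ z, Function.uncurry g z ∂(P.map fun ω => (X ω, Y ω)) := by
    rw [integral_map (hX.prodMk hY).aemeasurable hg.aestronglyMeasurable]
    rfl
  rw [h1, map_prodMk_eq_map_prod h hX hY,
    integral_map (hX.prodMap hY).aemeasurable hg.aestronglyMeasurable]
  rfl

/-- Disjoint groups of independent random variables are independent. -/
theorem iIndepFun_fiber {ι κ α : Type*} [Fintype ι] [Fintype κ] [DecidableEq κ]
    [MeasurableSpace α] [IsProbabilityMeasure P]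
    {X : ι → Ω → α} (h : iIndepFun X P) (hX : ∀ i, Measurable (X i)) (B : ι → κ) :
    iIndepFun (fun k ω (i : {i // B i = k}) => X i ω) P := by
  classical
  rw [iIndepFun_iff_measure_inter_preimage_eq_mul]
  intro s
  induction s using Finset.induction_on with
  | empty => intro sets _; simp
  | insert a s ha ih =>
    intro sets hsets
    rw [Finset.prod_insert ha, ← ih fun i hi => hsets i (Finset.mem_insert_of_mem hi)]
    rw [Finset.set_biInter_insert]
    -- The event for block `a` and the events for the blocks in `s` depend on disjoint sets of
    -- indices.
    have hdisj : Disjoint (Finset.univ.filter fun i => B i = a)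
        (Finset.univ.filter fun i => B i ∈ s) := by
      refine Finset.disjoint_filter.2 fun i _ h1 h2 => ha (h1 ▸ h2)
    have hind := h.indepFun_finset _ _ hdisj hX
    have hA : (fun ω (i : {i // B i = a}) => X i ω) ⁻¹' sets a =
        (fun ω (i : (Finset.univ.filter fun i => B i = a)) => X i ω) ⁻¹'
          ((fun x (i : {i // B i = a}) => x ⟨i, by simp [i.2]⟩) ⁻¹' sets a) := rfl
    have hC : (⋂ k ∈ s, (fun ω (i : {i // B i = k}) => X i ω) ⁻¹' sets k) =
        (fun ω (i : (Finset.univ.filter fun i => B i ∈ s)) => X i ω) ⁻¹'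
          (⋂ k : s, (fun x (i : {i // B i = (k : κ)}) => x ⟨i, by simp [i.2]⟩) ⁻¹' sets k) := by
      ext ω
      simp
    rw [hA, hC]
    refine hind.measure_inter_preimage_eq_mul _ _ ?_ ?_
    · exact measurableSet_preimage (by fun_prop) (hsets a (Finset.mem_insert_self _ _))
    · exact MeasurableSet.iInter fun k => measurableSet_preimage (by fun_prop)
        (hsets k (Finset.mem_insert_of_mem k.2))

/-- Attaching independent variables, living on a product space, to an independent family. -/
theorem iIndepFun_prodMk_pi {ι α β : Type*} [Fintype ι] [MeasurableSpace α] [MeasurableSpace β]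
    [IsProbabilityMeasure P] {ν : Measure β} [IsProbabilityMeasure ν]
    {X : ι → Ω → α} (h : iIndepFun X P) (hX : ∀ i, Measurable (X i)) :
    iIndepFun (fun i (p : Ω × (ι → β)) => (X i p.1, p.2 i))
      (P.prod (Measure.pi fun _ : ι => ν)) := by
  have hp : ∀ i, IsProbabilityMeasure (P.map (X i)) := fun i =>
    Measure.isProbabilityMeasure_map (hX i).aemeasurable
  have hmeas : ∀ i, Measurable (fun p : Ω × (ι → β) => (X i p.1, p.2 i)) := fun i =>
    ((hX i).comp measurable_fst).prodMk ((measurable_pi_apply i).comp measurable_snd)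
  rw [iIndepFun_iff_map_fun_eq_pi_map fun i => (hmeas i).aemeasurable]
  have hmarg : ∀ i, (P.prod (Measure.pi fun _ : ι => ν)).map
      (fun p : Ω × (ι → β) => (X i p.1, p.2 i)) = (P.map (X i)).prod ν := by
    intro i
    have h1 := Measure.map_prod_map P (Measure.pi fun _ : ι => ν) (hX i)
      (measurable_pi_apply (X := fun _ : ι => β) i)
    rw [(measurePreserving_eval (fun _ : ι => ν) i).map_eq] at h1
    exact h1.symm
  simp_rw [hmarg]
  have hjoint := Measure.map_prod_map P (Measure.pi fun _ : ι => ν)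
    (measurable_pi_lambda (fun ω i => X i ω) hX) measurable_id
  rw [Measure.map_id, h.map_fun_eq_pi_map fun i => (hX i).aemeasurable] at hjoint
  have he := (measurePreserving_arrowProdEquivProdArrow α β ι (fun i => P.map (X i))
    fun _ => ν).symm
  rw [← he.map_eq, hjoint, Measure.map_map (MeasurableEquiv.measurable _)
    ((measurable_pi_lambda _ hX).prodMap measurable_id)]
  rfl

end Independence

/-! ### Maxima of sums of independent vectors -/

section Sums

variable {F : Type*} [Fintype F] [Nonempty F] {Ω Ω' : Type*} [MeasurableSpace Ω]
  [MeasurableSpace Ω'] {P : Measure Ω} {P' : Measure Ω'}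

theorem Integrable.coordMax {U : Ω → F → ℝ} (hU : Integrable U P) :
    Integrable (fun ω => coordMax (U ω)) P :=
  hU.mono (continuous_coordMax.comp_aestronglyMeasurable hU.1)
    (Filter.Eventually.of_forall fun ω => abs_coordMax_le (U ω))

theorem integrable_coordMax_add_prod [IsProbabilityMeasure P] [IsProbabilityMeasure P']
    {U : Ω → F → ℝ} {V : Ω' → F → ℝ} (hU : Integrable U P) (hV : Integrable V P') (h : F → ℝ) :
    Integrable (fun p : Ω × Ω' => coordMax (h + (U p.1 + V p.2))) (P.prod P') :=
  MOM.Integrable.coordMax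
    ((integrable_const h).add ((hU.comp_fst P').add (hV.comp_snd P)))

theorem integral_coordMax_add_of_indepFun [IsProbabilityMeasure P] {U V : Ω → F → ℝ}
    (hUV : IndepFun U V P) (hUm : Measurable U) (hVm : Measurable V) (hU : Integrable U P)
    (hV : Integrable V P) (h : F → ℝ) :
    ∫ ω, coordMax (h + (U ω + V ω)) ∂P = ∫ ω, ∫ ω', coordMax (h + (U ω + V ω')) ∂P ∂P :=
  integral_comp_of_indepFun (g := fun x y => coordMax (h + (x + y))) hUV hUm hVm
    (measurable_coordMax.comp (by fun_prop)) (integrable_coordMax_add_prod hU hV h)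

/-- Summands of a sum of independent random vectors may be exchanged one by one. -/
theorem integral_coordMax_sum_le_sum {ι : Type*} [IsProbabilityMeasure P]
    [IsProbabilityMeasure P'] {V : ι → Ω → F → ℝ} {W : ι → Ω' → F → ℝ}
    (hV : iIndepFun V P) (hW : iIndepFun W P')
    (hVm : ∀ i, Measurable (V i)) (hWm : ∀ i, Measurable (W i))
    (hVi : ∀ i, Integrable (V i) P) (hWi : ∀ i, Integrable (W i) P')
    (s : Finset ι)
    (hVW : ∀ i ∈ s, ∀ h, ∫ ω, coordMax (h + V i ω) ∂P ≤ ∫ ω, coordMax (h + W i ω) ∂P')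
    (h : F → ℝ) :
    ∫ ω, coordMax (h + ∑ i ∈ s, V i ω) ∂P ≤ ∫ ω, coordMax (h + ∑ i ∈ s, W i ω) ∂P' := by
  classical
  induction s using Finset.induction_on generalizing h with
  | empty => simp
  | insert a s ha ih =>
    have hS : Integrable (fun ω => ∑ i ∈ s, V i ω) P := integrable_finsetSum _ fun i _ => hVi i
    have hT : Integrable (fun ω => ∑ i ∈ s, W i ω) P' := integrable_finsetSum _ fun i _ => hWi i
    have hSm : Measurable (fun ω => ∑ i ∈ s, V i ω) := by fun_prop
    have hTm : Measurable (fun ω => ∑ i ∈ s, W i ω) := by fun_prop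
    have hindV : IndepFun (V a) (fun ω => ∑ i ∈ s, V i ω) P := by
      convert (hV.indepFun_finsetSum_of_notMem hVm ha).symm using 1
      ext1 ω
      simp
    have hindW : IndepFun (W a) (fun ω => ∑ i ∈ s, W i ω) P' := by
      convert (hW.indepFun_finsetSum_of_notMem hWm ha).symm using 1
      ext1 ω
      simp
    have ih' := ih fun i hi => hVW i (Finset.mem_insert_of_mem hi)
    simp_rw [Finset.sum_insert ha]
    rw [integral_coordMax_add_of_indepFun hindV (hVm a) hSm (hVi a) hS,
      integral_coordMax_add_of_indepFun hindW (hWm a) hTm (hWi a) hT]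
    -- The shift `h` is arbitrary, so either part of the sum can be frozen into it: first the tail
    -- is exchanged with `V a` frozen, then, after Fubini, `V a` with the tail frozen.
    calc ∫ ω, ∫ ω', coordMax (h + (V a ω + ∑ i ∈ s, V i ω')) ∂P ∂P
        ≤ ∫ ω, ∫ ω', coordMax (h + (V a ω + ∑ i ∈ s, W i ω')) ∂P' ∂P := by
          refine integral_mono (integrable_coordMax_add_prod (hVi a) hS h).integral_prod_left
            (integrable_coordMax_add_prod (hVi a) hT h).integral_prod_left fun ω => ?_
          simpa only [add_assoc] using ih' (h + V a ω)
      _ = ∫ ω', ∫ ω, coordMax (h + (V a ω + ∑ i ∈ s, W i ω')) ∂P ∂P' :=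
          integral_integral_swap (integrable_coordMax_add_prod (hVi a) hT h)
      _ ≤ ∫ ω', ∫ ω, coordMax (h + (W a ω + ∑ i ∈ s, W i ω')) ∂P' ∂P' := by
          refine integral_mono (integrable_coordMax_add_prod (hVi a) hT h).integral_prod_right
            (integrable_coordMax_add_prod (hWi a) hT h).integral_prod_right fun ω => ?_
          have := hVW a (Finset.mem_insert_self _ _) (h + ∑ i ∈ s, W i ω)
          simpa only [add_assoc, add_comm (∑ i ∈ s, W i ω)] using this
      _ = _ := (integral_integral_swap (integrable_coordMax_add_prod (hWi a) hT h)).symm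

/-- Symmetrization of one centered summand. -/
theorem integral_coordMax_sub_integral_le [IsProbabilityMeasure P] {ξ : Ω → F → ℝ}
    (hξ : Integrable ξ P) (h : F → ℝ) :
    ∫ ω, coordMax (h + (ξ ω - fun v => ∫ ω, ξ ω v ∂P)) ∂P ≤
      (1 / 2) * ∫ ω, coordMax (h + (2 : ℝ) • ξ ω) ∂P +
        (1 / 2) * ∫ ω, coordMax (h - (2 : ℝ) • ξ ω) ∂P := by
  set m : F → ℝ := fun v => ∫ ω, ξ ω v ∂P with hm
  have i1 : Integrable (fun ω => coordMax (h + (2 : ℝ) • ξ ω)) P :=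
    MOM.Integrable.coordMax ((integrable_const h).add (hξ.smul (2 : ℝ)))
  have i2 : Integrable (fun ω => coordMax (h - (2 : ℝ) • ξ ω)) P :=
    MOM.Integrable.coordMax ((integrable_const h).sub (hξ.smul (2 : ℝ)))
  have i3 : Integrable (fun ω => coordMax (h + (ξ ω - m))) P :=
    MOM.Integrable.coordMax ((integrable_const h).add (hξ.sub (integrable_const m)))
  have jensen : coordMax (h - (2 : ℝ) • m) ≤ ∫ ω, coordMax (h - (2 : ℝ) • ξ ω) ∂P := by
    refine coordMax_le fun v => ?_
    have hξv : Integrable (fun ω => ξ ω v) P := hξ.eval v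
    have : (h - (2 : ℝ) • m) v = ∫ ω, (h v - 2 * ξ ω v) ∂P := by
      rw [integral_sub (integrable_const _) (hξv.const_mul 2), integral_const_mul]
      simp [hm]
    rw [this]
    exact integral_mono ((integrable_const _).sub (hξv.const_mul 2)) i2
      fun ω => le_coordMax (h - (2 : ℝ) • ξ ω) v
  calc ∫ ω, coordMax (h + (ξ ω - m)) ∂P
      ≤ ∫ ω, ((1 / 2) * coordMax (h + (2 : ℝ) • ξ ω) + (1 / 2) * coordMax (h - (2 : ℝ) • m)) ∂P :=
        integral_mono i3 ((i1.const_mul _).add (integrable_const _)) fun ω => by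
          have := coordMax_midpoint_le h (ξ ω) m
          rwa [add_sub_assoc] at this
    _ = (1 / 2) * ∫ ω, coordMax (h + (2 : ℝ) • ξ ω) ∂P + (1 / 2) * coordMax (h - (2 : ℝ) • m) := by
        rw [integral_add (i1.const_mul _) (integrable_const _), integral_const_mul]
        simp
    _ ≤ _ := by gcongr

theorem coordMax_mem_Icc_of_mem_Icc {h x : F → ℝ} (hx : ∀ v, x v ∈ Set.Icc (0 : ℝ) 1) :
    coordMax (h + x) ∈ Set.Icc (coordMax h) (coordMax h + 1) := by
  refine ⟨coordMax_le fun v => ?_, coordMax_le fun v => ?_⟩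
  · exact (le_add_of_nonneg_right (hx v).1).trans (le_coordMax (h + x) v)
  · exact add_le_add (le_coordMax h v) (hx v).2

/-- The bounded differences estimate for the moment generating function of the maximal coordinate
of a sum of independent vectors with coordinates in `[0, 1]`. -/
theorem integral_exp_coordMax_sum_le {ι : Type*} [IsProbabilityMeasure P] {V : ι → Ω → F → ℝ}
    (hV : iIndepFun V P) (hVm : ∀ i, Measurable (V i))
    (hV01 : ∀ i ω v, V i ω v ∈ Set.Icc (0 : ℝ) 1) (t : ℝ) (s : Finset ι) (h : F → ℝ) :
    ∫ ω, Real.exp (t * coordMax (h + ∑ i ∈ s, V i ω)) ∂P ≤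
      Real.exp (t * ∫ ω, coordMax (h + ∑ i ∈ s, V i ω) ∂P + s.card * (t ^ 2 / 8)) := by
  classical
  have hVi : ∀ i, Integrable (V i) P := fun i =>
    Integrable.of_bound (hVm i).aestronglyMeasurable 1 (Filter.Eventually.of_forall fun ω =>
      (pi_norm_le_iff_of_nonneg zero_le_one).2 fun v => by
        rw [Real.norm_eq_abs, abs_of_nonneg (hV01 i ω v).1]; exact (hV01 i ω v).2)
  induction s using Finset.induction_on generalizing h with
  | empty => simp
  | insert a s ha ih =>
    have hS : Integrable (fun ω => ∑ i ∈ s, V i ω) P := integrable_finsetSum _ fun i _ => hVi i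
    have hSm : Measurable (fun ω => ∑ i ∈ s, V i ω) := by fun_prop
    have hind : IndepFun (V a) (fun ω => ∑ i ∈ s, V i ω) P := by
      convert (hV.indepFun_finsetSum_of_notMem hVm ha).symm using 1
      ext1 ω
      simp
    -- This is the conditional mean of the maximum given `V a`. Coordinates of `V a` lie in `[0,
    -- 1]`, so it ranges over an interval of length 1 and Hoeffding's lemma applies.
    set g : Ω → ℝ := fun ω => ∫ ω', coordMax (h + (V a ω + ∑ i ∈ s, V i ω')) ∂P with hg
    have hpi := integrable_coordMax_add_prod (hVi a) hS h
    have hgi : Integrable g P := hpi.integral_prod_left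
    have hSi : ∀ x, Integrable (fun ω => coordMax (x + ∑ i ∈ s, V i ω)) P := fun x =>
      MOM.Integrable.coordMax ((integrable_const x).add hS)
    set c : ℝ := ∫ ω', coordMax (h + ∑ i ∈ s, V i ω') ∂P with hc
    have hgc : ∀ ω, g ω ∈ Set.Icc c (c + 1) := by
      intro ω
      have hmem : ∀ ω', coordMax (h + (V a ω + ∑ i ∈ s, V i ω')) ∈
          Set.Icc (coordMax (h + ∑ i ∈ s, V i ω')) (coordMax (h + ∑ i ∈ s, V i ω') + 1) := by
        intro ω'
        rw [add_comm (V a ω), ← add_assoc]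
        exact coordMax_mem_Icc_of_mem_Icc (hV01 a ω)
      have hi : Integrable (fun ω' => coordMax (h + (V a ω + ∑ i ∈ s, V i ω'))) P := by
        simpa only [add_assoc] using hSi (h + V a ω)
      refine ⟨integral_mono (hSi h) hi fun ω' => (hmem ω').1, ?_⟩
      have hone : c + 1 = ∫ ω', (coordMax (h + ∑ i ∈ s, V i ω') + 1) ∂P := by
        rw [integral_add (hSi h) (integrable_const _)]
        simp [hc]
      rw [hone]
      exact integral_mono hi ((hSi h).add (integrable_const _)) fun ω' => (hmem ω').2
    have hsub := (hasSubgaussianMGF_of_mem_Icc hgi.aemeasurable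
      (Filter.Eventually.of_forall hgc)).mgf_le t
    have hexp : Integrable (fun p : Ω × Ω =>
        Real.exp (t * coordMax (h + (V a p.1 + ∑ i ∈ s, V i p.2)))) (P.prod P) := by
      refine integrable_exp_mul_of_mem_Icc (a := coordMax h)
        (b := coordMax h + (1 + s.card)) hpi.aemeasurable (Filter.Eventually.of_forall fun p => ?_)
      have h0 : ∀ v, 0 ≤ (∑ i ∈ s, V i p.2) v ∧ (∑ i ∈ s, V i p.2) v ≤ s.card := by
        intro v
        rw [Finset.sum_apply]
        refine ⟨Finset.sum_nonneg fun i _ => (hV01 i _ v).1, ?_⟩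
        refine (Finset.sum_le_card_nsmul _ _ 1 fun i _ => (hV01 i _ v).2).trans ?_
        simp
      refine ⟨coordMax_le fun v => ?_, coordMax_le fun v => ?_⟩
      · refine le_trans ?_ (le_coordMax _ v)
        exact le_add_of_nonneg_right (add_nonneg (hV01 a _ v).1 (h0 v).1)
      · exact add_le_add (le_coordMax h v) (add_le_add (hV01 a _ v).2 (h0 v).2)
    have hgexp : Integrable (fun ω => Real.exp (t * g ω)) P :=
      integrable_exp_mul_of_mem_Icc hgi.aemeasurable (Filter.Eventually.of_forall hgc)
    simp_rw [Finset.sum_insert ha]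
    rw [integral_coordMax_add_of_indepFun hind (hVm a) hSm (hVi a) hS,
      integral_comp_of_indepFun (g := fun x y => Real.exp (t * coordMax (h + (x + y)))) hind
        (hVm a) hSm (by
          refine Real.measurable_exp.comp ((measurable_coordMax.comp ?_).const_mul t)
          fun_prop) hexp]
    calc ∫ ω, ∫ ω', Real.exp (t * coordMax (h + (V a ω + ∑ i ∈ s, V i ω'))) ∂P ∂P
        ≤ ∫ ω, Real.exp (s.card * (t ^ 2 / 8)) * Real.exp (t * g ω) ∂P := by
          refine integral_mono hexp.integral_prod_left (hgexp.const_mul _) fun ω => ?_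
          have := ih (h + V a ω)
          simp only [add_assoc] at this
          rwa [add_comm, Real.exp_add] at this
      _ = Real.exp (s.card * (t ^ 2 / 8)) * (Real.exp (t * ∫ ω, g ω ∂P) *
            mgf (fun ω => g ω - ∫ ω, g ω ∂P) P t) := by
          rw [integral_const_mul, mgf, ← integral_const_mul (Real.exp (t * ∫ ω, g ω ∂P))]
          congr 1
          refine integral_congr_ae (Filter.Eventually.of_forall fun ω => ?_)
          simp only
          rw [← Real.exp_add]
          congr 1
          ring
      _ ≤ Real.exp (s.card * (t ^ 2 / 8)) * (Real.exp (t * ∫ ω, g ω ∂P) *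
            Real.exp (t ^ 2 / 8)) := by
          gcongr
          -- An interval of length 1 has variance proxy `1 / 4`, whence `t ^ 2 / 8`.
          refine hsub.trans (le_of_eq ?_)
          congr 1
          simp
          ring
      _ = _ := by
          rw [← Real.exp_add, ← Real.exp_add, Finset.card_insert_of_notMem ha]
          congr 1
          push_cast
          simp only [hg]
          ring

/-- Concentration of the maximal coordinate of a sum of independent vectors with coordinates in
`[0, 1]`. -/
theorem measure_coordMax_sum_ge_le {ι : Type*} [IsProbabilityMeasure P] {V : ι → Ω → F → ℝ}
    (hV : iIndepFun V P) (hVm : ∀ i, Measurable (V i))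
    (hV01 : ∀ i ω v, V i ω v ∈ Set.Icc (0 : ℝ) 1) (s : Finset ι) (hs : s.Nonempty) {x : ℝ}
    (hx : 0 ≤ x) :
    P {ω | ∫ ω, coordMax (∑ i ∈ s, V i ω) ∂P + x ≤ coordMax (∑ i ∈ s, V i ω)} ≤
      ENNReal.ofReal (Real.exp (-2 * x ^ 2 / s.card)) := by
  have hn : (0 : ℝ) < s.card := by exact_mod_cast hs.card_pos
  -- This minimizes the Chernoff exponent `-t * x + s.card * t ^ 2 / 8`.
  set t : ℝ := 4 * x / s.card with ht
  have hmgf := integral_exp_coordMax_sum_le hV hVm hV01 t s 0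
  simp only [zero_add] at hmgf
  have hmeas : Measurable fun ω => coordMax (∑ i ∈ s, V i ω) := by fun_prop
  have hint : Integrable (fun ω => Real.exp (t * coordMax (∑ i ∈ s, V i ω))) P := by
    refine integrable_exp_mul_of_mem_Icc (a := 0) (b := s.card) hmeas.aemeasurable
      (Filter.Eventually.of_forall fun ω => ⟨?_, coordMax_le fun v => ?_⟩)
    · refine le_trans ?_ (le_coordMax _ (Classical.arbitrary F))
      rw [Finset.sum_apply]
      exact Finset.sum_nonneg fun i _ => (hV01 i _ _).1
    · rw [Finset.sum_apply]
      refine (Finset.sum_le_card_nsmul _ _ 1 fun i _ => (hV01 i _ v).2).trans ?_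
      simp
  have hch := measure_ge_le_exp_mul_mgf (μ := P) (X := fun ω => coordMax (∑ i ∈ s, V i ω))
    (∫ ω, coordMax (∑ i ∈ s, V i ω) ∂P + x) (t := t) (by positivity) hint
  rw [← ofReal_measureReal]
  refine ENNReal.ofReal_le_ofReal (hch.trans ((mul_le_mul_of_nonneg_left hmgf
    (Real.exp_pos _).le).trans (le_of_eq ?_)))
  rw [← Real.exp_add]
  congr 1
  rw [ht]
  field_simp
  ring

end Sums

/-! ### Symmetrization and contraction -/

section Symmetrization

instance : IsProbabilityMeasure rademacher := by
  refine ⟨?_⟩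
  simp [rademacher, ENNReal.inv_two_add_inv_two]

theorem integral_rademacher (f : ℝ → ℝ) :
    ∫ e, f e ∂rademacher = (1 / 2) * f (-1) + (1 / 2) * f 1 := by
  have h2 : (2⁻¹ : ℝ≥0∞) ≠ ∞ := by simp
  rw [rademacher, integral_add_measure (integrable_dirac (by simp)|>.smul_measure h2)
    (integrable_dirac (by simp)|>.smul_measure h2), integral_smul_measure, integral_smul_measure,
    integral_dirac, integral_dirac]
  simp

theorem integrable_id_rademacher : Integrable (fun e : ℝ => e) rademacher := by
  have h2 : (2⁻¹ : ℝ≥0∞) ≠ ∞ := by simp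
  rw [rademacher]
  exact (integrable_dirac (by simp)|>.smul_measure h2).add_measure
    (integrable_dirac (by simp)|>.smul_measure h2)

variable {F : Type*} [Fintype F] {Ω : Type*} [MeasurableSpace Ω] {P : Measure Ω}
  {ι : Type*} [Fintype ι]

theorem integrable_sign_smul {T : Ω → F → ℝ} (hT : Integrable T P) (i : ι) :
    Integrable (fun p : Ω × (ι → ℝ) => p.2 i • T p.1)
      (P.prod (Measure.pi fun _ : ι => rademacher)) := by
  have h1 : Integrable (fun e : ι → ℝ => e i) (Measure.pi fun _ : ι => rademacher) :=
    (measurePreserving_eval (fun _ : ι => rademacher) i).integrable_comp_of_integrable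
      integrable_id_rademacher
  refine Integrable.of_eval fun v => ?_
  simpa [mul_comm] using (hT.eval v).mul_prod h1

variable [IsProbabilityMeasure P]

theorem integrable_ramp_comp {T : Ω → F → ℝ} (hTm : Measurable T) :
    Integrable (fun ω v => ramp (T ω v)) P := by
  refine Integrable.of_bound (Measurable.aestronglyMeasurable ?_) 1
    (Filter.Eventually.of_forall fun ω => (pi_norm_le_iff_of_nonneg zero_le_one).2 fun v => ?_)
  · exact measurable_pi_lambda _ fun v => measurable_ramp.comp (by fun_prop)
  · rw [Real.norm_eq_abs, abs_of_nonneg (ramp_nonneg _)]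
    exact ramp_le_one _

variable [Nonempty F]

theorem integral_coordMax_add_sign_smul {T : Ω → F → ℝ} (hTm : Measurable T)
    (hT : Integrable T P) (i : ι) (h : F → ℝ) :
    ∫ p : Ω × (ι → ℝ), coordMax (h + p.2 i • T p.1)
        ∂(P.prod (Measure.pi fun _ : ι => rademacher)) =
      (1 / 2) * ∫ ω, coordMax (h + T ω) ∂P + (1 / 2) * ∫ ω, coordMax (h - T ω) ∂P := by
  have hint : Integrable (fun p : Ω × (ι → ℝ) => coordMax (h + p.2 i • T p.1))
      (P.prod (Measure.pi fun _ : ι => rademacher)) :=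
    MOM.Integrable.coordMax ((integrable_const h).add (integrable_sign_smul hT i))
  rw [integral_prod_symm _ hint]
  set G : ℝ → ℝ := fun e => ∫ ω, coordMax (h + e • T ω) ∂P with hG
  have hGm : StronglyMeasurable G := by
    refine StronglyMeasurable.integral_prod_right (f := fun e ω => coordMax (h + e • T ω)) ?_
    refine (measurable_coordMax.comp ?_).stronglyMeasurable
    fun_prop
  have h1 : ∫ e : ι → ℝ, G (e i) ∂(Measure.pi fun _ : ι => rademacher) = ∫ e, G e ∂rademacher := by
    have := integral_map (μ := Measure.pi fun _ : ι => rademacher) (φ := Function.eval i)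
      (measurable_pi_apply i).aemeasurable hGm.aestronglyMeasurable
    rw [(measurePreserving_eval (fun _ : ι => rademacher) i).map_eq] at this
    exact this.symm
  refine h1.trans ?_
  rw [integral_rademacher, hG]
  simp only [neg_smul, one_smul, ← sub_eq_add_neg]
  ring

/-- Symmetrization of one centered summand by a Rademacher sign. -/
theorem integral_coordMax_add_le_sign {T : Ω → F → ℝ} (hTm : Measurable T)
    (hT : Integrable T P) (hT0 : ∀ v, ∫ ω, T ω v ∂P = 0) (i : ι) (h : F → ℝ) :
    ∫ ω, coordMax (h + T ω) ∂P ≤ ∫ p : Ω × (ι → ℝ), coordMax (h + p.2 i • (2 : ℝ) • T p.1)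
        ∂(P.prod (Measure.pi fun _ : ι => rademacher)) := by
  rw [integral_coordMax_add_sign_smul (T := fun ω => (2 : ℝ) • T ω) (by fun_prop) (hT.smul (2 : ℝ))]
  have := integral_coordMax_sub_integral_le hT h
  simp only [hT0] at this
  refine le_trans (le_of_eq ?_) this
  congr 1
  ext ω
  congr 2
  ext v
  simp

/-- Symmetrization and contraction for one summand. -/
theorem integral_coordMax_ramp_sub_le {T : Ω → F → ℝ} (hTm : Measurable T) (hT : Integrable T P)
    (h : F → ℝ) :
    ∫ ω, coordMax (h + fun v => ramp (T ω v) - ∫ ω, ramp (T ω v) ∂P) ∂P ≤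
      (1 / 2) * ∫ ω, coordMax (h + (4 : ℝ) • T ω) ∂P +
        (1 / 2) * ∫ ω, coordMax (h - (4 : ℝ) • T ω) ∂P := by
  have hr : Integrable (fun ω v => ramp (T ω v)) P := integrable_ramp_comp hTm
  -- The constant 4 is the 2 of symmetrization times the Lipschitz constant 2 of the ramp.
  have hc : ∀ s t, |2 * ramp s - 2 * ramp t| ≤ 4 * |s - t| := by
    intro s t
    rw [← mul_sub, abs_mul, abs_two]
    linarith [abs_ramp_sub_le s t]
  have i1 : Integrable (fun ω => coordMax (h + (2 : ℝ) • fun v => ramp (T ω v))) P :=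
    MOM.Integrable.coordMax ((integrable_const h).add (hr.smul (2 : ℝ)))
  have i2 : Integrable (fun ω => coordMax (h - (2 : ℝ) • fun v => ramp (T ω v))) P :=
    MOM.Integrable.coordMax ((integrable_const h).sub (hr.smul (2 : ℝ)))
  have i3 : Integrable (fun ω => coordMax (h + (4 : ℝ) • T ω)) P :=
    MOM.Integrable.coordMax ((integrable_const h).add (hT.smul (4 : ℝ)))
  have i4 : Integrable (fun ω => coordMax (h - (4 : ℝ) • T ω)) P :=
    MOM.Integrable.coordMax ((integrable_const h).sub (hT.smul (4 : ℝ)))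
  refine (integral_coordMax_sub_integral_le hr h).trans ?_
  rw [← mul_add, ← mul_add, ← integral_add i1 i2, ← integral_add i3 i4]
  refine mul_le_mul_of_nonneg_left (integral_mono (i1.add i2) (i3.add i4) fun ω => ?_)
    (by norm_num)
  exact coordMax_contraction (φ := fun s => 2 * ramp s) hc h (T ω)

variable {κ : Type*} [Fintype κ] [DecidableEq κ] {B : ι → κ} {Y : ι → Ω → F → ℝ}

/-- The centered ramp process over blocks is controlled by the Rademacher process. -/
theorem integral_coordMax_sum_ramp_sub_le (hY : iIndepFun Y P) (hYm : ∀ i, Measurable (Y i))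
    (hYi : ∀ i, Integrable (Y i) P) (hY0 : ∀ i v, ∫ ω, Y i ω v ∂P = 0) :
    ∫ ω, coordMax (∑ k : κ, fun v => ramp (∑ i with B i = k, Y i ω v) -
        ∫ ω, ramp (∑ i with B i = k, Y i ω v) ∂P) ∂P ≤
      8 * ∫ p : Ω × (ι → ℝ), coordMax (∑ i, p.2 i • Y i p.1)
        ∂(P.prod (Measure.pi fun _ : ι => rademacher)) := by
  set Q := P.prod (Measure.pi fun _ : ι => rademacher) with hQ
  set T : κ → Ω → F → ℝ := fun k ω => ∑ i with B i = k, Y i ω with hT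
  have hTm : ∀ k, Measurable (T k) := fun k => by fun_prop
  have hTi : ∀ k, Integrable (T k) P := fun k => integrable_finsetSum _ fun i _ => hYi i
  set V : κ → Ω → F → ℝ := fun k ω v => ramp (T k ω v) - ∫ ω, ramp (T k ω v) ∂P with hV
  -- The 4 comes from symmetrizing and contracting a block, the 2 from attaching a sign to each data
  -- point.
  set E : ι → Ω × (ι → ℝ) → F → ℝ := fun i p => p.2 i • (2 : ℝ) • (4 : ℝ) • Y i p.1 with hE
  set W : κ → Ω × (ι → ℝ) → F → ℝ := fun k p => ∑ i with B i = k, E i p with hW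
  have hEm : ∀ i, Measurable (E i) := fun i => by fun_prop
  have hEi : ∀ i, Integrable (E i) Q := fun i =>
    integrable_sign_smul (((hYi i).smul (4 : ℝ)).smul (2 : ℝ)) i
  have hEind : iIndepFun E Q := by
    have := (iIndepFun_prodMk_pi (ν := rademacher) hY hYm).comp
      (fun _ q => q.2 • (2 : ℝ) • (4 : ℝ) • q.1) fun _ => by fun_prop
    exact this
  have fiberSum : ∀ {Z : ι → F → ℝ} (k : κ),
      ∑ i with B i = k, Z i = ∑ i : {i // B i = k}, Z i := fun k =>
    (Finset.sum_subtype _ (by simp) _)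
  have hVm : ∀ k, Measurable (V k) := fun k =>
    measurable_pi_lambda _ fun v => (measurable_ramp.comp (by fun_prop)).sub_const _
  have hVind : iIndepFun V P := by
    have := (iIndepFun_fiber hY hYm B).comp
      (fun k x v => ramp ((∑ i, x i) v) - ∫ ω, ramp (T k ω v) ∂P) fun k =>
        measurable_pi_lambda _ fun v => (measurable_ramp.comp (by fun_prop)).sub_const _
    convert this using 1
    ext k ω v
    simp only [hV, hT, Function.comp, fiberSum k]
  have hWind : iIndepFun W Q := by
    have := (iIndepFun_fiber hEind hEm B).comp
      (fun k x => ∑ i, x i) fun k => by fun_prop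
    convert this using 1
    ext1 k
    ext1 p
    simp only [hW, Function.comp, fiberSum k]
  have hVi : ∀ k, Integrable (V k) P := fun k =>
    (integrable_ramp_comp (hTm k)).sub (integrable_const fun v => ∫ ω, ramp (T k ω v) ∂P)
  have hWi : ∀ k, Integrable (W k) Q := fun k => integrable_finsetSum _ fun i _ => hEi i
  -- A block's centered ramp is bounded by the average over the two signs of `± 4 * T k`. Both signs
  -- are dominated by the same `W k`, so no block-level Rademacher variables are needed.
  have hstep : ∀ k h, ∫ ω, coordMax (h + V k ω) ∂P ≤ ∫ p, coordMax (h + W k p) ∂Q := by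
    intro k h
    have hplus : ∫ ω, coordMax (h + (4 : ℝ) • T k ω) ∂P ≤ ∫ p, coordMax (h + W k p) ∂Q := by
      simp_rw [hT, Finset.smul_sum]
      refine integral_coordMax_sum_le_sum (V := fun i ω => (4 : ℝ) • Y i ω)
        (hY.comp (fun _ x => (4 : ℝ) • x) fun _ => by fun_prop) hEind (fun i => by fun_prop)
        hEm (fun i => (hYi i).smul (4 : ℝ)) hEi _ (fun i _ h => ?_) h
      refine integral_coordMax_add_le_sign (by fun_prop) ((hYi i).smul (4 : ℝ)) (fun v => ?_) i h
      simp [integral_const_mul, hY0]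
    have hminus : ∫ ω, coordMax (h - (4 : ℝ) • T k ω) ∂P ≤ ∫ p, coordMax (h + W k p) ∂Q := by
      simp_rw [sub_eq_add_neg, ← neg_smul, hT, Finset.smul_sum]
      refine integral_coordMax_sum_le_sum (V := fun i ω => (-4 : ℝ) • Y i ω)
        (hY.comp (fun _ x => (-4 : ℝ) • x) fun _ => by fun_prop) hEind (fun i => by fun_prop)
        hEm (fun i => (hYi i).smul (-4 : ℝ)) hEi _ (fun i _ h => ?_) h
      refine (integral_coordMax_add_le_sign (T := fun ω => (-4 : ℝ) • Y i ω) (by fun_prop)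
        ((hYi i).smul (-4 : ℝ)) (fun v => ?_) i h).trans (le_of_eq ?_)
      · simp [integral_neg, integral_const_mul, hY0]
      -- A random sign absorbs the minus sign: both expectations are the same average over `±`.
      · rw [integral_coordMax_add_sign_smul (T := fun ω => (2 : ℝ) • (-4 : ℝ) • Y i ω)
            (by fun_prop) (((hYi i).smul (-4 : ℝ)).smul (2 : ℝ)),
          integral_coordMax_add_sign_smul (T := fun ω => (2 : ℝ) • (4 : ℝ) • Y i ω)
            (by fun_prop) (((hYi i).smul (4 : ℝ)).smul (2 : ℝ))]
        simp only [neg_smul, smul_neg, sub_neg_eq_add, ← sub_eq_add_neg]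
        ring
    have := integral_coordMax_ramp_sub_le (hTm k) (hTi k) h
    simp only [hV]
    linarith
  have hmain := integral_coordMax_sum_le_sum hVind hWind hVm (fun k => by fun_prop) hVi hWi
    Finset.univ (fun k _ h => hstep k h) 0
  simp only [zero_add] at hmain
  have hsum : ∀ p, ∑ k, W k p = (8 : ℝ) • ∑ i, p.2 i • Y i p.1 := by
    intro p
    rw [hW, Finset.sum_fiberwise, Finset.smul_sum]
    refine Finset.sum_congr rfl fun i _ => ?_
    rw [hE]
    simp only [smul_smul]
    congr 1
    ring
  simp_rw [hsum, coordMax_smul (show (0 : ℝ) ≤ 8 by norm_num), integral_const_mul] at hmain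
  simpa only [hV, hT, Finset.sum_apply] using hmain

/-- The expectation of the ramp process over blocks. -/
theorem integral_coordMax_sum_ramp_le (hY : iIndepFun Y P) (hYm : ∀ i, Measurable (Y i))
    (hYi : ∀ i, Integrable (Y i) P) (hY0 : ∀ i v, ∫ ω, Y i ω v ∂P = 0) {c : ℝ}
    (hc : ∀ k v, ∫ ω, ramp (∑ i with B i = k, Y i ω v) ∂P ≤ c) :
    ∫ ω, coordMax (∑ k : κ, fun v => ramp (∑ i with B i = k, Y i ω v)) ∂P ≤
      Fintype.card κ * c + 8 * ∫ p : Ω × (ι → ℝ), coordMax (∑ i, p.2 i • Y i p.1)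
        ∂(P.prod (Measure.pi fun _ : ι => rademacher)) := by
  have hTm : ∀ k, Measurable fun ω => (∑ i with B i = k, Y i ω) := fun k => by fun_prop
  have hr : ∀ k, Integrable (fun ω v => ramp (∑ i with B i = k, Y i ω v)) P := fun k => by
    simpa only [Finset.sum_apply] using integrable_ramp_comp (hTm k)
  refine le_trans ?_ (add_le_add_right (integral_coordMax_sum_ramp_sub_le (B := B) hY hYm hYi hY0) _)
  have i1 : Integrable (fun ω => coordMax (∑ k : κ, fun v =>
      ramp (∑ i with B i = k, Y i ω v))) P :=
    MOM.Integrable.coordMax (integrable_finsetSum _ fun k _ => hr k)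
  have i2 : Integrable (fun ω => coordMax (∑ k : κ, fun v => ramp (∑ i with B i = k, Y i ω v) -
        ∫ ω, ramp (∑ i with B i = k, Y i ω v) ∂P)) P :=
    MOM.Integrable.coordMax (integrable_finsetSum _ fun k _ => (hr k).sub (integrable_const _))
  have hconst : Fintype.card κ * c = ∫ _, (Fintype.card κ * c : ℝ) ∂P := by simp
  rw [hconst, ← integral_add (integrable_const _) i2]
  refine integral_mono i1 ((integrable_const _).add i2) fun ω => coordMax_le fun v => ?_
  have h1 := le_coordMax (∑ k : κ, fun v => ramp (∑ i with B i = k, Y i ω v) -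
        ∫ ω, ramp (∑ i with B i = k, Y i ω v) ∂P) v
  have h2 : ∑ k : κ, ∫ ω, ramp (∑ i with B i = k, Y i ω v) ∂P ≤ Fintype.card κ * c := by
    refine (Finset.sum_le_card_nsmul _ _ c fun k _ => hc k v).trans ?_
    simp
  rw [Finset.sum_apply, Finset.sum_sub_distrib] at h1
  rw [Finset.sum_apply]
  linarith

end Symmetrization

/-! ### The moments that enter the rate -/

section Moments

variable {d : ℕ} {Ω : Type*} [MeasurableSpace Ω] {P : Measure Ω}

theorem norm_sqrt_sq_eq {Sig : Matrix (Fin d) (Fin d) ℝ} (hSig : Sig.PosSemidef)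
    (v : EuclideanSpace ℝ (Fin d)) :
    ‖Matrix.toEuclideanLin (CFC.sqrt Sig) v‖ ^ 2 = v.ofLp ⬝ᵥ (Sig.mulVec v.ofLp) := by
  have h0 : 0 ≤ Sig := Matrix.nonneg_iff_posSemidef.2 hSig
  have hs : (CFC.sqrt Sig).IsHermitian :=
    (Matrix.nonneg_iff_posSemidef.1 (CFC.sqrt_nonneg Sig)).isHermitian
  have hss : CFC.sqrt Sig * CFC.sqrt Sig = Sig := CFC.sqrt_mul_sqrt_self Sig h0
  rw [EuclideanSpace.real_norm_sq_eq]
  nth_rewrite 2 [← hss]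
  rw [← Matrix.mulVec_mulVec, Matrix.dotProduct_mulVec, ← Matrix.mulVec_transpose]
  have ht : (CFC.sqrt Sig).transpose = CFC.sqrt Sig := by
    rw [← Matrix.conjTranspose_eq_transpose_of_trivial]
    exact hs
  rw [ht]
  simp [dotProduct, pow_two, Matrix.toLpLin_apply]

theorem integral_inner_sq_eq [IsFiniteMeasure P] {Y : Ω → EuclideanSpace ℝ (Fin d)}
    (hY : MemLp Y 2 P) (μ v : EuclideanSpace ℝ (Fin d)) :
    ∫ ω, ⟪v, Y ω - μ⟫ ^ 2 ∂P = v.ofLp ⬝ᵥ ((secondMoment P Y μ).mulVec v.ofLp) := by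
  have hc : ∀ a, MemLp (fun ω => Y ω a - μ a) 2 P := fun a =>
    (hY.eval_piLp a).sub (memLp_const _)
  have hi : ∀ a b, Integrable (fun ω => v a * (v b * ((Y ω a - μ a) * (Y ω b - μ b)))) P :=
    fun a b => (((hc a).integrable_mul (hc b)).const_mul _).const_mul _
  have hexp : ∀ ω, ⟪v, Y ω - μ⟫ ^ 2 =
      ∑ a, ∑ b, v a * (v b * ((Y ω a - μ a) * (Y ω b - μ b))) := by
    intro ω
    rw [PiLp.inner_apply, pow_two, Finset.sum_mul_sum]
    refine Finset.sum_congr rfl fun a _ => Finset.sum_congr rfl fun b _ => ?_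
    simp
    ring
  simp_rw [hexp]
  rw [integral_finsetSum _ fun a _ => integrable_finsetSum _ fun b _ => hi a b]
  simp_rw [integral_finsetSum _ fun b _ => hi _ b, integral_const_mul]
  simp only [dotProduct, Matrix.mulVec, Finset.mul_sum, secondMoment, Matrix.of_apply]
  refine Finset.sum_congr rfl fun a _ => Finset.sum_congr rfl fun b _ => ?_
  ring

theorem integral_inner_sq_le [IsFiniteMeasure P] {Y : Ω → EuclideanSpace ℝ (Fin d)}
    (hY : MemLp Y 2 P) {μ : EuclideanSpace ℝ (Fin d)} {Sig : Matrix (Fin d) (Fin d) ℝ}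
    (hSig : Sig.PosSemidef) (hcov : (Sig - secondMoment P Y μ).PosSemidef)
    (v : EuclideanSpace ℝ (Fin d)) :
    ∫ ω, ⟪v, Y ω - μ⟫ ^ 2 ∂P ≤ ‖Matrix.toEuclideanLin (CFC.sqrt Sig) v‖ ^ 2 := by
  rw [integral_inner_sq_eq hY, norm_sqrt_sq_eq hSig]
  have := hcov.dotProduct_mulVec_nonneg v.ofLp
  rw [Matrix.sub_mulVec, dotProduct_sub] at this
  simpa using this

/-- Bridges the signed maximum over finitely many directions and the `[0, ∞]`-valued complexity,
whose integrand is truncated at `0`. -/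
theorem ofReal_integral_le_lintegral {f : Ω → ℝ} (hf : Integrable f P) :
    ENNReal.ofReal (∫ ω, f ω ∂P) ≤ ∫⁻ ω, ENNReal.ofReal (f ω) ∂P := by
  calc ENNReal.ofReal (∫ ω, f ω ∂P) ≤ ENNReal.ofReal (∫ ω, max (f ω) 0 ∂P) :=
        ENNReal.ofReal_le_ofReal (integral_mono hf hf.pos_part fun ω => le_max_left _ _)
    _ = ∫⁻ ω, ENNReal.ofReal (max (f ω) 0) ∂P :=
        ofReal_integral_eq_lintegral_ofReal hf.pos_part
          (Filter.Eventually.of_forall fun ω => le_max_right _ _)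
    _ = _ := by simp [ENNReal.ofReal_max]

variable {N : ℕ} {S : Set (EuclideanSpace ℝ (Fin d))} {Sig : Matrix (Fin d) (Fin d) ℝ} {K : ℕ}
  {X : Fin N → Ω → EuclideanSpace ℝ (Fin d)} {μ : EuclideanSpace ℝ (Fin d)} {r : ℝ}

theorem norm_sqrt_sq_le_of_rate_le (hN : 1 ≤ N) (hK : 0 < K) (hr : 0 ≤ r)
    (hrate : rate P S Sig K X μ ≤ ENNReal.ofReal r) {v : EuclideanSpace ℝ (Fin d)} (hv : v ∈ S) :
    ‖Matrix.toEuclideanLin (CFC.sqrt Sig) v‖ ^ 2 ≤ r ^ 2 * N / (64 * K) := by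
  have hN0 : (0 : ℝ) < N := by exact_mod_cast hN
  have hK0 : (0 : ℝ) < K := by exact_mod_cast hK
  have h1 : ENNReal.ofReal ‖Matrix.toEuclideanLin (CFC.sqrt Sig) v‖ ≤ weakVariance S Sig :=
    le_iSup₂ (f := fun w (_ : w ∈ S) =>
      ENNReal.ofReal ‖Matrix.toEuclideanLin (CFC.sqrt Sig) w‖) v hv
  have h2 := (mul_le_mul_left h1 (ENNReal.ofReal (√(64 * K / N)))).trans
    ((le_max_right _ _).trans hrate)
  rw [← ENNReal.ofReal_mul (norm_nonneg _), ENNReal.ofReal_le_ofReal_iff hr] at h2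
  have h3 := pow_le_pow_left₀ (by positivity) h2 2
  rw [mul_pow, Real.sq_sqrt (by positivity)] at h3
  rw [le_div_iff₀ (by positivity)]
  calc _ = ‖Matrix.toEuclideanLin (CFC.sqrt Sig) v‖ ^ 2 * (64 * K / N) * N := by field_simp
    _ ≤ _ := by gcongr

theorem integral_coordMax_inner_le_of_rate_le [IsProbabilityMeasure P] (hN : 1 ≤ N) (hr : 0 ≤ r)
    (hrate : rate P S Sig K X μ ≤ ENNReal.ofReal r)
    (hX : ∀ i, Integrable (X i) P) (F : Finset (EuclideanSpace ℝ (Fin d))) [Nonempty F]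
    (hF : ∀ v ∈ F, v ∈ S) :
    ∫ p : Ω × (Fin N → ℝ), coordMax (∑ i, p.2 i • fun v : F => ⟪v.1, X i p.1 - μ⟫)
      ∂(P.prod (Measure.pi fun _ : Fin N => rademacher)) ≤ r * N / 64 := by
  have hN0 : (0 : ℝ) < N := by exact_mod_cast hN
  have hint : Integrable (fun p : Ω × (Fin N → ℝ) =>
      coordMax (∑ i, p.2 i • fun v : F => ⟪v.1, X i p.1 - μ⟫))
      (P.prod (Measure.pi fun _ : Fin N => rademacher)) := by
    refine MOM.Integrable.coordMax (integrable_finsetSum _ fun i _ => integrable_sign_smul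
      (T := fun ω (v : F) => ⟪v.1, X i ω - μ⟫) (Integrable.of_eval fun v => ?_) i)
    exact ((hX i).sub (integrable_const μ)).const_inner v.1
  have h1 : ENNReal.ofReal (64 / √(N : ℝ)) * rademacherComplexity P S X μ ≤ ENNReal.ofReal r :=
    (le_max_left _ _).trans hrate
  have h2 : ∀ p : Ω × (Fin N → ℝ),
      ENNReal.ofReal (coordMax (∑ i, p.2 i • fun v : F => ⟪v.1, X i p.1 - μ⟫)) ≤
      ENNReal.ofReal √(N : ℝ) *
        pseudoNorm S ((√(N : ℝ))⁻¹ • ∑ i, p.2 i • (X i p.1 - μ)) := by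
    intro p
    obtain ⟨v, hv⟩ := exists_coordMax_eq (∑ i, p.2 i • fun v : F => ⟪v.1, X i p.1 - μ⟫)
    have h3 : (∑ i, p.2 i • fun v : F => ⟪v.1, X i p.1 - μ⟫) v =
        √(N : ℝ) * ⟪v.1, (√(N : ℝ))⁻¹ • ∑ i, p.2 i • (X i p.1 - μ)⟫ := by
      rw [inner_smul_right, inner_sum, mul_inv_cancel_left₀ (by positivity), Finset.sum_apply]
      simp [inner_smul_right]
    rw [hv, h3, ENNReal.ofReal_mul (by positivity)]
    gcongr
    exact le_iSup₂ (f := fun w (_ : w ∈ S) =>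
      ENNReal.ofReal ⟪w, (√(N : ℝ))⁻¹ • ∑ i, p.2 i • (X i p.1 - μ)⟫) v.1 (hF _ v.2)
  have h4 := (ofReal_integral_le_lintegral hint).trans (lintegral_mono h2)
  rw [lintegral_const_mul' _ _ ENNReal.ofReal_ne_top] at h4
  -- Here `√N = (N / 64) * (64 / √N)` isolates the first term of the rate.
  have h5 : ENNReal.ofReal √(N : ℝ) * rademacherComplexity P S X μ ≤
      ENNReal.ofReal (N / 64) * ENNReal.ofReal r := by
    refine le_trans (le_of_eq ?_) (mul_le_mul_right h1 _)
    rw [← mul_assoc, ← ENNReal.ofReal_mul (by positivity)]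
    congr 2
    nth_rewrite 2 [← Real.mul_self_sqrt hN0.le]
    field_simp
  rw [← ENNReal.ofReal_mul (by positivity)] at h5
  refine ((ENNReal.ofReal_le_ofReal_iff (by positivity)).1 (h4.trans h5)).trans (le_of_eq ?_)
  ring

end Moments

/-! ### The deviation of the block means -/

section Deviation

variable {d N K : ℕ} {Ω : Type*} [MeasurableSpace Ω] {P : Measure Ω} [IsProbabilityMeasure P]
  {S : Set (EuclideanSpace ℝ (Fin d))} {Sig : Matrix (Fin d) (Fin d) ℝ} {B : Fin N → Fin K}
  {X : Fin N → Ω → EuclideanSpace ℝ (Fin d)} {μ : EuclideanSpace ℝ (Fin d)} {r : ℝ}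

theorem inner_blockMean_sub (hN : 1 ≤ N) (hB : IsEquipartition B)
    (x : Fin N → EuclideanSpace ℝ (Fin d)) (k : Fin K) (v : EuclideanSpace ℝ (Fin d)) :
    ⟪blockMean B x k - μ, v⟫ = ∑ i with B i = k, (K : ℝ) / N * ⟪v, x i - μ⟫ := by
  have hcard : (K : ℝ) * (Finset.univ.filter fun i => B i = k).card = N := by
    exact_mod_cast hB k
  have hN0 : (N : ℝ) ≠ 0 := by positivity
  have hm : ((Finset.univ.filter fun i => B i = k).card : ℝ) ≠ 0 := by
    intro h0
    rw [h0, mul_zero] at hcard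
    exact hN0 hcard.symm
  have hK : (K : ℝ) / N = ((Finset.univ.filter fun i => B i = k).card : ℝ)⁻¹ := by
    rw [← hcard]
    have : (K : ℝ) ≠ 0 := by
      intro h0
      rw [h0, zero_mul] at hcard
      exact hN0 hcard.symm
    field_simp
  rw [real_inner_comm, inner_sub_right, blockMean, inner_smul_right, inner_sum, ← Finset.mul_sum,
    hK]
  simp_rw [inner_sub_right]
  rw [Finset.sum_sub_distrib, Finset.sum_const, nsmul_eq_mul, mul_sub, inv_mul_cancel_left₀ hm]

theorem integral_sum_sq_eq {ι : Type*} {Z : ι → Ω → ℝ} (hZ : iIndepFun Z P)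
    (hZ2 : ∀ i, MemLp (Z i) 2 P) (hZ0 : ∀ i, ∫ ω, Z i ω ∂P = 0) (s : Finset ι) :
    ∫ ω, (∑ i ∈ s, Z i ω) ^ 2 ∂P = ∑ i ∈ s, ∫ ω, Z i ω ^ 2 ∂P := by
  have h := IndepFun.variance_sum (s := s) (fun i _ => hZ2 i)
    fun i _ j _ hij => hZ.indepFun hij
  have h0 : ∫ ω, (∑ i ∈ s, Z i) ω ∂P = 0 := by
    simp only [Finset.sum_apply]
    rw [integral_finsetSum _ fun i _ => (hZ2 i).integrable (by norm_num)]
    simp [hZ0]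
  rw [variance_of_integral_eq_zero (by
    exact Finset.aemeasurable_sum _ fun i _ => (hZ2 i).1.aemeasurable) h0] at h
  simp only [Finset.sum_apply] at h
  rw [h]
  exact Finset.sum_congr rfl fun i _ => variance_of_integral_eq_zero (hZ2 i).1.aemeasurable (hZ0 i)

/-- On a finite set of directions, few block means deviate by more than the rate. -/
theorem measure_exists_many_deviating_blocks_le (hN : 1 ≤ N) (hK : 0 < K)
    (hB : IsEquipartition B) (hXm : ∀ i, Measurable (X i)) (hXind : iIndepFun X P)
    (hX2 : ∀ i, MemLp (X i) 2 P) (hmean : ∀ i, ∫ ω, X i ω ∂P = μ) (hSig : Sig.PosSemidef)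
    (hcov : ∀ i, (Sig - secondMoment P (X i) μ).PosSemidef) (hr : 0 < r)
    (hrate : rate P S Sig K X μ ≤ ENNReal.ofReal r) (F : Finset (EuclideanSpace ℝ (Fin d)))
    (hF : ∀ v ∈ F, v ∈ S) :
    P {ω | ∃ v ∈ F, 11 * K ≤
        64 * (Finset.univ.filter fun k => r < ⟪blockMean B (fun i => X i ω) k - μ, v⟫).card} ≤
      ENNReal.ofReal (Real.exp (-(K : ℝ) / 512)) := by
  rcases F.eq_empty_or_nonempty with rfl | hne
  · simp
  have : Nonempty F := hne.to_subtype
  have hN0 : (0 : ℝ) < N := by exact_mod_cast hN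
  have hK0 : (0 : ℝ) < K := by exact_mod_cast hK
  -- With this scaling, summing `Y` over a block gives its mean's deviation in units of `r`.
  set a : ℝ := K / (N * r) with ha
  have ha0 : 0 < a := by positivity
  have hX1 : ∀ i, Integrable (X i) P := fun i => (hX2 i).integrable (by norm_num)
  set Y : Fin N → Ω → F → ℝ := fun i ω v => a * ⟪v.1, X i ω - μ⟫ with hY
  have hYm : ∀ i, Measurable (Y i) := fun i => by fun_prop
  have hYind : iIndepFun Y P :=
    hXind.comp (fun _ x (v : F) => a * ⟪v.1, x - μ⟫) fun _ => by fun_prop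
  have hYi : ∀ i, Integrable (Y i) P := fun i => Integrable.of_eval fun v =>
    (((hX1 i).sub (integrable_const μ)).const_inner v.1).const_mul a
  have hY0 : ∀ i v, ∫ ω, Y i ω v ∂P = 0 := by
    intro i v
    simp only [hY]
    rw [integral_const_mul, integral_inner (f := fun ω => X i ω - μ)
      ((hX1 i).sub (integrable_const μ)), integral_sub (hX1 i) (integrable_const μ), hmean]
    simp
  have hY2 : ∀ i v, MemLp (fun ω => Y i ω v) 2 P := fun i v =>
    (((hX2 i).sub (memLp_const μ)).const_inner v.1).const_mul a
  have hsum : ∀ ω k (v : F), ∑ i with B i = k, Y i ω v =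
      r⁻¹ * ⟪blockMean B (fun i => X i ω) k - μ, v.1⟫ := by
    intro ω k v
    rw [inner_blockMean_sub hN hB, Finset.mul_sum]
    refine Finset.sum_congr rfl fun i _ => ?_
    simp only [hY, ha]
    field_simp
  have hcard : ∀ k, (K : ℝ) * (Finset.univ.filter fun i => B i = k).card = N := fun k => by
    exact_mod_cast hB k
  have hramp : ∀ k v, ∫ ω, ramp (∑ i with B i = k, Y i ω v) ∂P ≤ 1 / 64 := by
    intro k v
    have hsq : ∀ i, ∫ ω, Y i ω v ^ 2 ∂P ≤ a ^ 2 * (r ^ 2 * N / (64 * K)) := by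
      intro i
      simp only [hY, mul_pow]
      rw [integral_const_mul]
      gcongr
      exact (integral_inner_sq_le (hX2 i) hSig (hcov i) v.1).trans
        (norm_sqrt_sq_le_of_rate_le hN hK hr.le hrate (hF _ v.2))
    calc ∫ ω, ramp (∑ i with B i = k, Y i ω v) ∂P
        ≤ ∫ ω, (∑ i with B i = k, Y i ω v) ^ 2 ∂P := by
          refine integral_mono ?_ ?_ fun ω => ramp_le_sq _
          · simpa only [Finset.sum_apply] using
              (integrable_ramp_comp (P := P) (T := fun ω => ∑ i with B i = k, Y i ω)
                (by fun_prop)).eval v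
          · exact (memLp_finsetSum _ fun i _ => hY2 i v).integrable_sq
      _ = ∑ i with B i = k, ∫ ω, Y i ω v ^ 2 ∂P :=
          integral_sum_sq_eq (hYind.comp (fun _ x => x v) fun _ => by fun_prop)
            (fun i => hY2 i v) (fun i => hY0 i v) _
      _ ≤ (Finset.univ.filter fun i => B i = k).card * (a ^ 2 * (r ^ 2 * N / (64 * K))) := by
          rw [← nsmul_eq_mul]
          exact Finset.sum_le_card_nsmul _ _ _ fun i _ => hsq i
      _ = (K * (Finset.univ.filter fun i => B i = k).card) / N / 64 := by
          rw [ha]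
          field_simp
      _ = 1 / 64 := by
          rw [hcard]
          field_simp
  have hrad : ∫ p : Ω × (Fin N → ℝ), coordMax (∑ i, p.2 i • Y i p.1)
      ∂(P.prod (Measure.pi fun _ : Fin N => rademacher)) ≤ K / 64 := by
    have hpt : ∀ p : Ω × (Fin N → ℝ), coordMax (∑ i, p.2 i • Y i p.1) =
        a * coordMax (∑ i, p.2 i • fun v : F => ⟪v.1, X i p.1 - μ⟫) := by
      intro p
      rw [← coordMax_smul ha0.le, Finset.smul_sum]
      congr 1
      refine Finset.sum_congr rfl fun i _ => ?_
      ext v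
      simp only [hY, Pi.smul_apply, smul_eq_mul]
      ring
    simp_rw [hpt]
    rw [integral_const_mul]
    refine (mul_le_mul_of_nonneg_left (integral_coordMax_inner_le_of_rate_le hN hr.le hrate hX1 F
      hF) ha0.le).trans (le_of_eq ?_)
    rw [ha]
    field_simp
  -- The expected maximum is at most `K / 64 + 8 * (K / 64) = 9 * K / 64`.
  have hexp := integral_coordMax_sum_ramp_le (B := B) hYind hYm hYi hY0 hramp
  rw [Fintype.card_fin] at hexp
  set V : Fin K → Ω → F → ℝ := fun k ω v => ramp (∑ i with B i = k, Y i ω v) with hV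
  have hVm : ∀ k, Measurable (V k) := fun k =>
    measurable_pi_lambda _ fun v => measurable_ramp.comp (by fun_prop)
  have hVind : iIndepFun V P := by
    have := (iIndepFun_fiber hYind hYm B).comp (fun k x v => ramp (∑ i, x i v)) fun k =>
      measurable_pi_lambda _ fun v => measurable_ramp.comp (by fun_prop)
    convert this using 1
    ext k ω v
    simp only [hV, Function.comp]
    rw [Finset.sum_subtype (p := fun i => B i = k) _ (by simp)]
  have hneK : (Finset.univ : Finset (Fin K)).Nonempty := ⟨⟨0, hK⟩, Finset.mem_univ _⟩
  -- The deviation `K / 32` raises `9 * K / 64` to `11 * K / 64`.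
  have hdev := measure_coordMax_sum_ge_le hVind hVm
    (fun k ω v => ⟨ramp_nonneg _, ramp_le_one _⟩) Finset.univ hneK
    (show (0 : ℝ) ≤ K / 32 by positivity)
  have heq : -2 * ((K : ℝ) / 32) ^ 2 / (Finset.univ : Finset (Fin K)).card = -(K : ℝ) / 512 := by
    rw [Finset.card_univ, Fintype.card_fin]
    field_simp
    norm_num
  rw [heq] at hdev
  refine (measure_mono fun ω hω => ?_).trans hdev
  obtain ⟨v, hvF, hv⟩ := hω
  have h1 := le_coordMax (∑ k, V k ω) ⟨v, hvF⟩
  have h2 : ((Finset.univ.filter fun k => r < ⟪blockMean B (fun i => X i ω) k - μ, v⟫).card : ℝ) ≤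
      (∑ k, V k ω) ⟨v, hvF⟩ := by
    rw [Finset.sum_apply, Finset.card_filter]
    push_cast
    refine Finset.sum_le_sum fun k _ => ?_
    split_ifs with hk
    · simp only [hV, hsum]
      rw [ramp_of_one_le]
      rw [le_inv_mul_iff₀ hr, mul_one]
      exact hk.le
    · exact ramp_nonneg _
  have h3 : (11 * K : ℝ) ≤ 64 *
      (Finset.univ.filter fun k => r < ⟪blockMean B (fun i => X i ω) k - μ, v⟫).card := by
    exact_mod_cast hv
  simp only [Set.mem_ofPred_eq]
  linarith

end Deviation

/-! ### From finitely many directions to all directions -/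

section AllDirections

/-- A subset of a separable metrizable space is contained in the closure of an increasing union of
finite subsets. -/
theorem exists_monotone_finset_dense {E : Type*} [TopologicalSpace E] [SecondCountableTopology E]
    (S : Set E) : ∃ F : ℕ → Finset E, Monotone F ∧ (∀ n, ∀ v ∈ F n, v ∈ S) ∧
      S ⊆ closure (⋃ n, (F n : Set E)) := by
  classical
  obtain ⟨D, hDc, hDd⟩ := TopologicalSpace.exists_countable_dense S
  rcases S.eq_empty_or_nonempty with rfl | hne
  · exact ⟨fun _ => ∅, monotone_const, by simp, by simp⟩
  have : Nonempty S := hne.to_subtype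
  obtain ⟨f, rfl⟩ := hDc.exists_eq_range hDd.nonempty
  refine ⟨fun n => (Finset.range (n + 1)).image fun i => (f i : E), ?_, ?_, ?_⟩
  · intro m n hmn
    exact Finset.image_subset_image (Finset.range_mono (by omega))
  · intro n v hv
    obtain ⟨i, -, rfl⟩ := Finset.mem_image.1 hv
    exact (f i).2
  · intro v hv
    have h1 : (⟨v, hv⟩ : S) ∈ closure (Set.range f) := hDd _
    have h2 := image_closure_subset_closure_image continuous_subtype_val
      (Set.mem_image_of_mem (Subtype.val) h1)
    refine closure_mono ?_ h2
    rintro _ ⟨_, ⟨i, rfl⟩, rfl⟩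
    exact Set.mem_iUnion.2 ⟨i, by
      simp only [Finset.coe_image, Set.mem_image, Finset.mem_coe, Finset.mem_range]
      exact ⟨i, by omega, rfl⟩⟩

variable {d N K : ℕ} {Ω : Type*} [MeasurableSpace Ω] {P : Measure Ω} [IsProbabilityMeasure P]
  {S : Set (EuclideanSpace ℝ (Fin d))} {Sig : Matrix (Fin d) (Fin d) ℝ} {B : Fin N → Fin K}
  {X : Fin N → Ω → EuclideanSpace ℝ (Fin d)} {μ : EuclideanSpace ℝ (Fin d)}

/-- Uniformly over all directions, few block means deviate by more than the rate. -/
theorem exists_measurableSet_few_deviating_blocks (hN : 1 ≤ N) (hK : 0 < K)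
    (hB : IsEquipartition B) (hXm : ∀ i, Measurable (X i)) (hXind : iIndepFun X P)
    (hX2 : ∀ i, MemLp (X i) 2 P) (hmean : ∀ i, ∫ ω, X i ω ∂P = μ) (hSig : Sig.PosSemidef)
    (hcov : ∀ i, (Sig - secondMoment P (X i) μ).PosSemidef) {r : ℝ} (hr : 0 ≤ r)
    (hrate : rate P S Sig K X μ ≤ ENNReal.ofReal r) {G : Set Ω} (hG : ∀ᵐ ω ∂P, ω ∈ G) :
    ∃ A : Set Ω, MeasurableSet A ∧ ENNReal.ofReal (1 - Real.exp (-(K : ℝ) / 512)) ≤ P A ∧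
      ∀ ω ∈ A, ω ∈ G ∧ ∀ v ∈ S, 64 *
        (Finset.univ.filter fun k => r < ⟪blockMean B (fun i => X i ω) k - μ, v⟫).card
          < 11 * K := by
  obtain ⟨F, hFmono, hFS, hFd⟩ := exists_monotone_finset_dense S
  -- The slack `1 / (n + 1)` makes the threshold positive even if `r = 0`, and shrinks so that these
  -- events increase with `n`.
  set bad : ℕ → Set Ω := fun n => {ω | ∃ v ∈ F n, 11 * K ≤ 64 * (Finset.univ.filter fun k =>
    r + 1 / ((n : ℝ) + 1) < ⟪blockMean B (fun i => X i ω) k - μ, v⟫).card} with hbad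
  have hbadP : ∀ n, P (bad n) ≤ ENNReal.ofReal (Real.exp (-(K : ℝ) / 512)) := fun n =>
    measure_exists_many_deviating_blocks_le hN hK hB hXm hXind hX2 hmean hSig hcov
      (by positivity) (hrate.trans (ENNReal.ofReal_le_ofReal (by
        have : (0 : ℝ) < 1 / ((n : ℝ) + 1) := by positivity
        linarith))) (F n) (hFS n)
  have hbadmono : Monotone bad := by
    rintro m n hmn ω ⟨v, hv, hle⟩
    refine ⟨v, hFmono hmn hv, hle.trans ?_⟩
    have : 1 / ((n : ℝ) + 1) ≤ 1 / ((m : ℝ) + 1) := by gcongr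
    gcongr
  have hU : P (⋃ n, bad n) ≤ ENNReal.ofReal (Real.exp (-(K : ℝ) / 512)) := by
    rw [hbadmono.measure_iUnion]
    exact iSup_le hbadP
  -- Neither the modified data nor `G` need be measurable, so the complement of a measurable hull
  -- serves as the good event.
  set U : Set Ω := (⋃ n, bad n) ∪ Gᶜ with hUdef
  have hPU : P (toMeasurable P U) ≤ ENNReal.ofReal (Real.exp (-(K : ℝ) / 512)) := by
    rw [measure_toMeasurable]
    refine (measure_union_le _ _).trans ?_
    rw [show P Gᶜ = 0 from hG, add_zero]
    exact hU
  refine ⟨(toMeasurable P U)ᶜ, (measurableSet_toMeasurable P U).compl, ?_, fun ω hω => ?_⟩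
  · rw [prob_compl_eq_one_sub (measurableSet_toMeasurable P U),
      ENNReal.ofReal_sub _ (Real.exp_pos _).le, ENNReal.ofReal_one]
    exact tsub_le_tsub_left hPU 1
  have hωU : ω ∉ U := fun h => hω (subset_toMeasurable P U h)
  refine ⟨by_contra fun h => hωU (Or.inr h), fun v hv => ?_⟩
  by_contra! hle
  refine hωU (Or.inl ?_)
  set z := blockMean B (fun i => X i ω) with hz
  set J := Finset.univ.filter fun k => r < ⟪z k - μ, v⟫ with hJ
  -- The finitely many strict inequalities at `v` persist at a nearby `w` in some `F m`, and there
  -- leave room for the slack once `n` is large.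
  have hopen : IsOpen {w | ∀ k ∈ J, r < ⟪z k - μ, w⟫} := by
    have : {w | ∀ k ∈ J, r < ⟪z k - μ, w⟫} = ⋂ k ∈ J, {w | r < ⟪z k - μ, w⟫} := by
      ext w
      simp
    rw [this]
    exact isOpen_biInter_finset fun k _ => isOpen_lt continuous_const (by fun_prop)
  obtain ⟨w, hwJ, hwF⟩ := mem_closure_iff.1 (hFd hv) _ hopen
    fun k hk => (Finset.mem_filter.1 hk).2
  obtain ⟨m, hm⟩ := Set.mem_iUnion.1 hwF
  have hev : ∀ᶠ n : ℕ in Filter.atTop, ∀ k ∈ J, r + 1 / ((n : ℝ) + 1) < ⟪z k - μ, w⟫ := by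
    refine (Filter.eventually_all_finset J).2 fun k hk => ?_
    have := (tendsto_one_div_add_atTop_nhds_zero_nat (𝕜 := ℝ)).const_add r
    rw [add_zero] at this
    exact this.eventually_lt_const (hwJ k hk)
  obtain ⟨n, hn, hmn⟩ := (hev.and (Filter.eventually_ge_atTop m)).exists
  refine Set.mem_iUnion.2 ⟨n, w, hFmono hmn hm, hle.trans ?_⟩
  gcongr
  exact fun k hk => Finset.mem_filter.2 ⟨Finset.mem_univ _, hn k hk⟩

end AllDirections

end MOM

end

/-! ### The main theorem: corrupted blocks and conclusion -/

theorem theorem5 {Ω : Type*} [MeasurableSpace Ω] (P : Measure Ω) [IsProbabilityMeasure P]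
    (d N K o : ℕ) (hN : 1 ≤ N) (hK4 : 4 ∣ K + 1) (hKo : 16 * o < K)
    -- equipartition of the indices into `K` blocks
    (B : Fin N → Fin K) (hB : MOM.IsEquipartition B)
    -- the inliers: independent, with mean `μstar` and covariance at most `Sig`
    (Xt : Fin N → Ω → EuclideanSpace ℝ (Fin d)) (hXt_meas : ∀ i, Measurable (Xt i))
    (hXt_indep : iIndepFun Xt P) (hXt_L2 : ∀ i, MemLp (Xt i) 2 P)
    (μstar : EuclideanSpace ℝ (Fin d)) (hXt_mean : ∀ i, ∫ ω, Xt i ω ∂P = μstar)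
    (Sig : Matrix (Fin d) (Fin d) ℝ) (hSig : Sig.PosSemidef)
    (hXt_cov : ∀ i, (Sig - MOM.secondMoment P (Xt i) μstar).PosSemidef)
    -- the observed data: at most `o` vectors are modified, in an arbitrary way
    (X : Fin N → Ω → EuclideanSpace ℝ (Fin d))
    (hX : ∀ᵐ ω ∂P, {i | X i ω ≠ Xt i ω}.ncard ≤ o)
    (S : Set (EuclideanSpace ℝ (Fin d))) (hS : ∀ v ∈ S, -v ∈ S) :
    ∃ A : Set Ω, MeasurableSet A ∧ ENNReal.ofReal (1 - Real.exp (-(K : ℝ) / 512)) ≤ P A ∧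
      ∀ ω ∈ A,
        (∀ μf : EuclideanSpace ℝ (Fin d),
          IsMinOn (MOM.fenchelLegendre S (MOM.interQuartileMean B fun i => X i ω)) Set.univ μf →
            MOM.pseudoNorm S (μf - μstar) ≤ 2 * MOM.rate P S Sig K Xt μstar) ∧
        (∀ μg : EuclideanSpace ℝ (Fin d),
          IsMinOn (MOM.fenchelLegendre S (MOM.blockMedian B fun i => X i ω)) Set.univ μg →
            MOM.pseudoNorm S (μg - μstar) ≤ 2 * MOM.rate P S Sig K Xt μstar) := by
  have hK : 0 < K := by omega
  -- An infinite rate makes both bounds vacuous.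
  by_cases htop : MOM.rate P S Sig K Xt μstar = ∞
  · refine ⟨Set.univ, MeasurableSet.univ, ?_, fun ω _ => ?_⟩
    · rw [measure_univ, ← ENNReal.ofReal_one]
      exact ENNReal.ofReal_le_ofReal (sub_le_self _ (Real.exp_pos _).le)
    · simp [htop]
  set r : ℝ := (MOM.rate P S Sig K Xt μstar).toReal with hr
  have hrate : ENNReal.ofReal r = MOM.rate P S Sig K Xt μstar := ENNReal.ofReal_toReal htop
  obtain ⟨A, hAm, hAP, hA⟩ := MOM.exists_measurableSet_few_deviating_blocks hN hK hB hXt_meas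
    hXt_indep hXt_L2 hXt_mean hSig hXt_cov ENNReal.toReal_nonneg hrate.ge hX
  refine ⟨A, hAm, hAP, fun ω hω => ?_⟩
  obtain ⟨hmod, hdev⟩ := hA ω hω
  have hcount : ∀ v ∈ S, 4 * (Finset.univ.filter fun k =>
      r < ⟪MOM.blockMean B (fun i => X i ω) k - μstar, v⟫).card < K + 1 := by
    intro v hv
    have h1 : 64 * (Finset.univ.filter fun k =>
      r < ⟪MOM.blockMean B (fun i => Xt i ω) k - μstar, v⟫).card < 11 * K := hdev v hv
    have h2 := MOM.card_blockMean_le (B := B) (x := fun i => X i ω) (y := fun i => Xt i ω)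
      fun z => r < ⟪z - μstar, v⟫
    have h3 : {i | X i ω ≠ Xt i ω}.ncard ≤ o := hmod
    -- Since `o < K / 16`, the total is below `11 * K / 64 + 4 * K / 64`, hence below `(K + 1) / 4`.
    omega
  -- Symmetry of `S` supplies the lower tail, as the upper tail in direction `-v`.
  have happrox := fun v hv => MOM.abs_interQuartileMean_sub_le hK4 (hcount v hv)
    (hcount (-v) (hS v hv))
  have h2r : ENNReal.ofReal (2 * r) = 2 * MOM.rate P S Sig K Xt μstar := by
    rw [ENNReal.ofReal_mul zero_le_two, hrate, ENNReal.ofReal_ofNat]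
  rw [← h2r]
  exact ⟨fun μf hμf => MOM.pseudoNorm_sub_le_of_isMinOn (fun v hv => (happrox v hv).1) hμf,
    fun μg hμg => MOM.pseudoNorm_sub_le_of_isMinOn (fun v hv => (happrox v hv).2) hμg⟩
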